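/- \textbf{Setting.} Let $\mu>0$ and $0<\beta<\sqrt{\mu}$, and let $f:\mathbb{R}\to[0,1]$ be measurable with $f(x)+f(-x)\le 1$ for all $x$. The optical mode is $\mathcal{H}_C=L^2(\mathbb{R})$, where $\langle x|$ evaluates the wave function at $x$. The $n$-photon state has wave function $(2/\pi)^{1/4}(n!)^{-1/2}\mathrm{He}_n(2x)e^{-x^2}$ (with $\mathrm{He}_n$ the probabilists' Hermite polynomial), and the coherent state $|b\rangle$, $b\in\mathbb{R}$, has wave function $(2/\pi)^{1/4}e^{-(x-b)^2}$. $\Pi_{\rm ev}$ and $\Pi_{\rm od}$ are the projections onto the closed spans of the even and of the odd photon-number states. $A$ and $B$ are qubits with basis $|0\rangle,|1\rangle$, $|\pm\rangle=(|0\rangle\pm|1\rangle)/\sqrt2$, Pauli matrix $X$, and $\text{C-}X_{BA}=|0\rangle\langle0|_B\otimes I_A+|1\rangle\langle1|_B\otimes X_A$. All operator integrals are meant weakly, i.e. through their matrix elements. \textbf{Phase error operator.} Let $q=(1-e^{-2(\mu-\beta^2)})/2$, let $g_{m,V}$ be the density of the normal law with mean $m$ and variance $V$, put $v_\pm(x)=\sqrt{g_{\beta,1/4}(x)}\,|0\rangle\pm\sqrt{g_{-\beta,1/4}(x)}\,|1\rangle$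 and $$\tau_{AB}(x)=(1-q)\,|v_+(x)\rangle\langle v_+(x)|_A\otimes|+\rangle\langle+|_B+q\,|v_-(x)\rangle\langle v_-(x)|_A\otimes|-\rangle\langle-|_B .$$ The Hermitian matrix $\langle0|_B\tau_{AB}(x)|1\rangle_B$ has one positive and one negative eigenvalue; let $u_+(x),u_-(x)$ be corresponding unit eigenvectors and $W(x)=|u_+(x)\rangle\langle u_+(x)|-|u_-(x)\rangle\langle u_-(x)|$. Put $V(x)=\bigl(|0\rangle\langle0|_B\otimes I_A+|1\rangle\langle1|_B\otimes W(x)_A\bigr)\,\text{C-}X_{BA}$, $K(x)=\sqrt{f(x)}\,(|0\rangle_B\langle x|_C+|1\rangle_B\langle -x|_C)$, and $$M^{\rm hom}_{\rm ph}=\int_{-\infty}^{\infty}dx\,[I_A\otimes K(x)^\dagger]\,V(x)^\dagger\,(I_A\otimes|-\rangle\langle-|_B)\,V(x)\,[I_A\otimes K(x)]$$ on $\mathbb{C}^2_A\otimes\mathcal{H}_C$. Further let $\Pi^{\rm fid}=|0\rangle\langle0|_A\otimes|\beta\rangle\langle\beta|+|1\rangle\langle1|_A\otimes|{-\beta}\rangle\langle{-\beta}|$,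 $\Pi^{\rm trash}_-=|-\rangle\langle-|_A\otimes I_C$, and $M^{\rm hom}[\kappa,\gamma]=M^{\rm hom}_{\rm ph}+\kappa\,\Pi^{\rm fid}-\gamma\,\Pi^{\rm trash}_-$. \textbf{Parameters.} Let $\theta(x)$ be defined by $|\theta(x)|\le\pi/2$ and $\tan\theta(x)=e^{-2(\mu-\beta^2)}\sinh(4\beta x)$. Put $$M_{\rm oo}=\int f(x)[1+\cos\theta(x)]\,\Pi_{\rm od}|x\rangle\langle x|\Pi_{\rm od}\,dx,\quad M_{\rm ee}=\int f(x)[1-\cos\theta(x)]\,\Pi_{\rm ev}|x\rangle\langle x|\Pi_{\rm ev}\,dx,$$ $$M_{\rm oe}=\int f(x)\sin\theta(x)\,\Pi_{\rm od}|x\rangle\langle x|\Pi_{\rm ev}\,dx,\qquad M'_{\rm oe}=\int -f(x)\sin\theta(x)\,\Pi_{\rm od}|x\rangle\langle x|\Pi_{\rm ev}\,dx,$$ $M_{\rm eo}=M_{\rm oe}^\dagger$, and $$C_{\rm o}=\langle\beta|\Pi_{\rm od}|\beta\rangle,\quad C_{\rm e}=\langle\beta|\Pi_{\rm ev}|\beta\rangle,\quad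 \lambda_{\rm oo}=C_{\rm o}^{-1}\langle\beta|M_{\rm oo}|\beta\rangle,\quad \lambda_{\rm ee}=C_{\rm e}^{-1}\langle\beta|M_{\rm ee}|\beta\rangle,\quad \lambda_{\rm oe}=(C_{\rm o}C_{\rm e})^{-1/2}\langle\beta|M_{\rm oe}|\beta\rangle,$$ $$\sigma_{\rm oo}=\bigl(C_{\rm o}^{-1}\|M_{\rm oo}|\beta\rangle\|^2-\lambda_{\rm oo}^2\bigr)^{1/2},\qquad \sigma_{\rm eo}=\bigl(C_{\rm o}^{-1}\|M_{\rm eo}|\beta\rangle\|^2-\lambda_{\rm oe}^2\bigr)^{1/2},$$ $$\sigma_{\rm oe}=\sigma_{\rm oo}^{-1}\bigl((C_{\rm o}C_{\rm e})^{-1/2}\langle\beta|M_{\rm oo}M_{\rm oe}|\beta\rangle-\lambda_{\rm oo}\lambda_{\rm oe}\bigr),\qquad \sigma_{\rm ee}=\sigma_{\rm eo}^{-1}\bigl((C_{\rm o}C_{\rm e})^{-1/2}\langle\beta|M_{\rm oe}M_{\rm ee}|\beta\rangle-\lambda_{\rm oe}\lambda_{\rm ee}\bigr),$$ $$\Delta_{\rm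 oe}=\bigl(C_{\rm e}^{-1}\|M_{\rm oe}|\beta\rangle\|^2-\lambda_{\rm oe}^2-\sigma_{\rm oe}^2\bigr)^{1/2},\qquad \Delta_{\rm ee}=\bigl(C_{\rm e}^{-1}\|M_{\rm ee}|\beta\rangle\|^2-\lambda_{\rm ee}^2-\sigma_{\rm ee}^2\bigr)^{1/2},$$ where $\sigma_{\rm oe}:=0$ if $\sigma_{\rm oo}=0$ and $\sigma_{\rm ee}:=0$ if $\sigma_{\rm eo}=0$. For $\kappa,\gamma\in\mathbb{R}$ let $$M_{\rm 6d}^{(0)}=\begin{pmatrix}1&0&0&\Delta_{\rm oe}&0&0\\0&1&\sigma_{\rm oo}&\sigma_{\rm oe}&0&0\\0&\sigma_{\rm oo}&\kappa C_{\rm o}+\lambda_{\rm oo}&\kappa\sqrt{C_{\rm o}C_{\rm e}}+\lambda_{\rm oe}&\sigma_{\rm eo}&0\\\Delta_{\rm oe}&\sigma_{\rm oe}&\kappa\sqrt{C_{\rm o}C_{\rm e}}+\lambda_{\rm oe}&\kappa C_{\rm e}+\lambda_{\rm ee}-\gamma&\sigma_{\rm ee}&\Delta_{\rm ee}\\0&0&\sigma_{\rm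 eo}&\sigma_{\rm ee}&1-\gamma&0\\0&0&0&\Delta_{\rm ee}&0&1-\gamma\end{pmatrix},$$ $$M_{\rm 6d}^{(1)}=\begin{pmatrix}1-\gamma&0&0&\Delta_{\rm oe}&0&0\\0&1-\gamma&\sigma_{\rm oo}&-\sigma_{\rm oe}&0&0\\0&\sigma_{\rm oo}&\kappa C_{\rm o}+\lambda_{\rm oo}-\gamma&\kappa\sqrt{C_{\rm o}C_{\rm e}}-\lambda_{\rm oe}&\sigma_{\rm eo}&0\\\Delta_{\rm oe}&-\sigma_{\rm oe}&\kappa\sqrt{C_{\rm o}C_{\rm e}}-\lambda_{\rm oe}&\kappa C_{\rm e}+\lambda_{\rm ee}&-\sigma_{\rm ee}&\Delta_{\rm ee}\\0&0&\sigma_{\rm eo}&-\sigma_{\rm ee}&1&0\\0&0&0&\Delta_{\rm ee}&0&1\end{pmatrix},$$ and let $B^{\rm hom}(\kappa,\gamma)$ be the larger of the largest eigenvalues of $M_{\rm 6d}^{(0)}$ and $M_{\rm 6d}^{(1)}$. \textbf{Claim.} The integrals above define bounded operators; $M'_{\rm oe}=-M_{\rm oe}$; $C_{\rm o}=e^{-\beta^2}\sinh\beta^2$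 and $C_{\rm e}=e^{-\beta^2}\cosh\beta^2$; the matrix elements $\langle\beta|\cdot|\beta\rangle$ above are real; $B^{\rm hom}$ is a convex function of $(\kappa,\gamma)$; and for all $\kappa,\gamma\ge0$ $$M^{\rm hom}[\kappa,\gamma]\le B^{\rm hom}(\kappa,\gamma)\,I_{AC}.$$ -/

import Mathlib

open MeasureTheory
open scoped Kronecker Matrix

namespace HomodyneQKD

noncomputable section

/-! ### Operator-valued integrals in the weak sense -/

section WeakIntegral

variable {H : Type*} [NormedAddCommGroup H] [InnerProductSpace ℂ H]

/-- `M = ∫ dx Q(x)` in the weak sense, where `Q x φ ψ` is the matrix element `⟨φ|Q(x)|ψ⟩` of a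
sesquilinear form (such as `⟨φ|x⟩⟨x|ψ⟩`): every matrix element is integrable and integrates to
the corresponding matrix element of the bounded operator `M`. Such an `M` is unique. -/
def IsOpIntegral (Q : ℝ → H → H → ℂ) (M : H →L[ℂ] H) : Prop :=
  ∀ φ ψ : H, Integrable (fun x => Q x φ ψ) ∧ inner ℂ φ (M ψ) = ∫ x, Q x φ ψ

open Classical in
/-- The bounded operator `∫ dx Q(x)` (and `0` if the weak integral does not exist). -/
def opIntegral (Q : ℝ → H → H → ℂ) : H →L[ℂ] H :=
  if h : ∃ M, IsOpIntegral Q M then h.choose else 0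

end WeakIntegral

/-! ### The optical mode `C` -/

/-- The Hilbert space of the optical pulse, in the position (quadrature) representation:
the bra `⟨x|` evaluates the wave function at `x`. -/
abbrev ModeC : Type := Lp ℂ 2 (volume : Measure ℝ)

theorem memLp_polynomial_mul_gaussian (p : Polynomial ℝ) :
    MemLp (fun x : ℝ => p.eval x * Real.exp (-x ^ 2)) 2 (volume : Measure ℝ) := by
  induction p using Polynomial.induction_on' with
  | add p q hp hq =>
    have h := hp.add hq
    refine h.ae_eq (Filter.Eventually.of_forall fun x => ?_)
    simp [add_mul]
  | monomial n a =>
    have hm : AEStronglyMeasurable (fun x : ℝ => x ^ n * Real.exp (-x ^ 2)) volume :=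
      (by fun_prop : Continuous fun x : ℝ => x ^ n * Real.exp (-x ^ 2)).aestronglyMeasurable
    have h : MemLp (fun x : ℝ => x ^ n * Real.exp (-x ^ 2)) 2 (volume : Measure ℝ) := by
      rw [memLp_two_iff_integrable_sq hm]
      have h0 : (-1 : ℝ) < ((2 * n : ℕ) : ℝ) :=
        lt_of_lt_of_le (by norm_num) (Nat.cast_nonneg _)
      have hi := integrable_rpow_mul_exp_neg_mul_sq (b := 2) (by norm_num) h0
      refine hi.congr (Filter.Eventually.of_forall fun x => ?_)
      simp only [Real.rpow_natCast]
      rw [mul_pow, ← pow_mul, ← Real.exp_nat_mul, mul_comm n 2]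
      congr 2
      push_cast
      ring
    refine (h.const_mul a).ae_eq (Filter.Eventually.of_forall fun x => ?_)
    simp [mul_assoc]

/-- The wave function of the `n`-photon state, with the quadrature normalized such that the
vacuum has variance `1/4`. (`Polynomial.hermite` is the probabilists' Hermite polynomial, the
orthogonal polynomial of the standard normal law of `2x`.) -/
def numberWave (n : ℕ) (x : ℝ) : ℝ :=
  (2 / Real.pi) ^ (1 / 4 : ℝ) / Real.sqrt (n.factorial : ℝ)
    * (Polynomial.aeval (2 * x) (Polynomial.hermite n) * Real.exp (-x ^ 2))

theorem memLp_numberWave (n : ℕ) :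
    MemLp (fun x : ℝ => (numberWave n x : ℂ)) 2 (volume : Measure ℝ) := by
  refine MemLp.ofReal (MemLp.const_mul ?_ _)
  have h := memLp_polynomial_mul_gaussian
    (((Polynomial.hermite n).map (Int.castRingHom ℝ)).comp (2 * Polynomial.X))
  refine h.ae_eq (Filter.Eventually.of_forall fun x => ?_)
  simp only [Polynomial.eval_comp, Polynomial.eval_mul, Polynomial.eval_ofNat, Polynomial.eval_X]
  rw [Polynomial.aeval_def, Polynomial.eval_map]
  rfl

/-- The photon-number state `|n⟩`. -/
def numberState (n : ℕ) : ModeC := (memLp_numberWave n).toLp _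

/-- The projection onto the subspace of even photon numbers. -/
def projEven : ModeC →L[ℂ] ModeC :=
  (Submodule.span ℂ (Set.range fun k : ℕ => numberState (2 * k))).topologicalClosure.starProjection

/-- The projection onto the subspace of odd photon numbers. -/
def projOdd : ModeC →L[ℂ] ModeC :=
  (Submodule.span ℂ
    (Set.range fun k : ℕ => numberState (2 * k + 1))).topologicalClosure.starProjection

/-- The wave function `⟨x|b⟩` of the coherent state with real amplitude `b`. -/
def coherentWave (b x : ℝ) : ℝ :=
  (2 / Real.pi) ^ (1 / 4 : ℝ) * Real.exp (-(x - b) ^ 2)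

theorem memLp_coherentWave (b : ℝ) :
    MemLp (fun x : ℝ => (coherentWave b x : ℂ)) 2 (volume : Measure ℝ) := by
  refine MemLp.ofReal (MemLp.const_mul ?_ _)
  have h := (memLp_polynomial_mul_gaussian 1).comp_measurePreserving
    (measurePreserving_sub_right (volume : Measure ℝ) b)
  refine h.ae_eq (Filter.Eventually.of_forall fun x => ?_)
  simp

/-- The coherent state `|b⟩` with real amplitude `b`. -/
def coherentState (b : ℝ) : ModeC := (memLp_coherentWave b).toLp _

/-! ### Qubits -/

/-- The vectors `|0⟩`, `|1⟩`, `|+⟩`, `|-⟩` of a qubit. -/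
def ket0 : Fin 2 → ℂ := ![1, 0]
def ket1 : Fin 2 → ℂ := ![0, 1]
def ketPlus : Fin 2 → ℂ := ![1 / (Real.sqrt 2 : ℂ), 1 / (Real.sqrt 2 : ℂ)]
def ketMinus : Fin 2 → ℂ := ![1 / (Real.sqrt 2 : ℂ), -(1 / (Real.sqrt 2 : ℂ))]

/-- `P̂(v) = |v⟩⟨v|`. -/
def dyad (v : Fin 2 → ℂ) : Matrix (Fin 2) (Fin 2) ℂ := Matrix.vecMulVec v (star v)

/-- The Pauli matrix `X`. -/
def pauliX : Matrix (Fin 2) (Fin 2) ℂ := !![0, 1; 1, 0]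

/-- Operators on the two qubits `A`, `B`; the index is the pair (basis label of `A`, of `B`). -/
abbrev OpAB : Type := Matrix (Fin 2 × Fin 2) (Fin 2 × Fin 2) ℂ

/-- Controlled-NOT with control `B` and target `A`. -/
def cnotBA : OpAB := (1 : Matrix (Fin 2) (Fin 2) ℂ) ⊗ₖ dyad ket0 + pauliX ⊗ₖ dyad ket1

/-! ### The twisting operation -/

/-- `q_{μ,β} = (1 - e^{-2(μ-β²)})/2`. -/
def qParam (μ β : ℝ) : ℝ := (1 - Real.exp (-2 * (μ - β ^ 2))) / 2

/-- The vector `√g_{β,1/4}(x) |0⟩ + s √g_{-β,1/4}(x) |1⟩`, where `g_{m,V}` is the density of the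
normal law with mean `m` and variance `V`. -/
def gaussVec (β s x : ℝ) : Fin 2 → ℂ :=
  ![(Real.sqrt (ProbabilityTheory.gaussianPDFReal β (1 / 4) x) : ℂ),
    (s : ℂ) * (Real.sqrt (ProbabilityTheory.gaussianPDFReal (-β) (1 / 4) x) : ℂ)]

/-- The operator `τ_{AB}^{hom}(x)`. -/
def tauHom (μ β x : ℝ) : OpAB :=
  ((1 - qParam μ β : ℝ) : ℂ) • (dyad (gaussVec β 1 x) ⊗ₖ dyad ketPlus)
    + ((qParam μ β : ℝ) : ℂ) • (dyad (gaussVec β (-1) x) ⊗ₖ dyad ketMinus)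

/-- The operator `⟨0|_B τ_{AB}^{hom}(x) |1⟩_B` on `A`. -/
def tauHom01 (μ β x : ℝ) : Matrix (Fin 2) (Fin 2) ℂ :=
  Matrix.of fun a a' => tauHom μ β x (a, 0) (a', 1)

/-- `W_A^{hom}(x) = |u₊⟩⟨u₊| - |u₋⟩⟨u₋|`, where `u₊`, `u₋` are the unit eigenvectors of the
Hermitian matrix `⟨0|_B τ_{AB}^{hom}(x) |1⟩_B` with positive and negative eigenvalue. It is the
unitary factor of the polar decomposition of that matrix. -/
def twistW (μ β x : ℝ) : Matrix (Fin 2) (Fin 2) ℂ := cfc Real.sign (tauHom01 μ β x)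

/-- The controlled unitary `V^{hom}_{B;A→A}(x)`, with `V⁽⁰⁾ = I` and `V⁽¹⁾ = W`. -/
def twistV (μ β x : ℝ) : OpAB :=
  ((1 : Matrix (Fin 2) (Fin 2) ℂ) ⊗ₖ dyad ket0 + twistW μ β x ⊗ₖ dyad ket1) * cnotBA

/-! ### Operators on the joint system `AC` -/

/-- The Hilbert space of Alice's qubit and the optical pulse: `ψ` stands for
`|0⟩ ⊗ ψ 0 + |1⟩ ⊗ ψ 1`. -/
abbrev SpaceAC : Type := PiLp 2 (fun _ : Fin 2 => ModeC)

/-- The operator `P ⊗ T` on `AC`. -/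
def tensorAC (P : Matrix (Fin 2) (Fin 2) ℂ) (T : ModeC →L[ℂ] ModeC) : SpaceAC →L[ℂ] SpaceAC :=
  ((PiLp.continuousLinearEquiv 2 ℂ (fun _ : Fin 2 => ModeC)).symm :
      (Fin 2 → ModeC) →L[ℂ] SpaceAC) ∘L
    ContinuousLinearMap.pi fun i =>
      ∑ j, P i j • (T ∘L PiLp.proj (𝕜 := ℂ) 2 (fun _ : Fin 2 => ModeC) j)

/-- `(I_A ⊗ K_suc^{hom}(x)) ψ`, with `K_suc^{hom}(x) = √f(x) (|0⟩_B⟨x|_C + |1⟩_B⟨-x|_C)`. -/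
def krausHom (f : ℝ → ℝ) (x : ℝ) (ψ : SpaceAC) : Fin 2 × Fin 2 → ℂ := fun ab =>
  (Real.sqrt (f x) : ℂ) * (ket0 ab.2 * (ψ ab.1 : ℝ → ℂ) x + ket1 ab.2 * (ψ ab.1 : ℝ → ℂ) (-x))

/-- The matrix elements of `[I ⊗ K(x)†] V(x)† (I_A ⊗ |-⟩⟨-|_B) V(x) [I ⊗ K(x)]`. -/
def phaseErrorForm (f : ℝ → ℝ) (μ β x : ℝ) (φ ψ : SpaceAC) : ℂ :=
  star (krausHom f x φ) ⬝ᵥ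
    (((twistV μ β x)ᴴ * ((1 : Matrix (Fin 2) (Fin 2) ℂ) ⊗ₖ dyad ketMinus) * twistV μ β x)
      *ᵥ krausHom f x ψ)

/-- The phase error operator `M_ph^{hom}`. -/
def phaseErrorOp (f : ℝ → ℝ) (μ β : ℝ) : SpaceAC →L[ℂ] SpaceAC :=
  opIntegral (phaseErrorForm f μ β)

/-- `Π^{fid} = |0⟩⟨0| ⊗ |β⟩⟨β| + |1⟩⟨1| ⊗ |-β⟩⟨-β|`. -/
def projFid (β : ℝ) : SpaceAC →L[ℂ] SpaceAC :=
  tensorAC (dyad ket0) (InnerProductSpace.rankOne ℂ (coherentState β) (coherentState β))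
    + tensorAC (dyad ket1) (InnerProductSpace.rankOne ℂ (coherentState (-β)) (coherentState (-β)))

/-- `Π^{trash}_- = |-⟩⟨-| ⊗ I`. -/
def projTrash : SpaceAC →L[ℂ] SpaceAC := tensorAC (dyad ketMinus) (ContinuousLinearMap.id ℂ ModeC)

/-- `M^{hom}[κ,γ] = M_ph^{hom} + κ Π^{fid} - γ Π^{trash}_-`. -/
def opM (f : ℝ → ℝ) (μ β κ γ : ℝ) : SpaceAC →L[ℂ] SpaceAC :=
  phaseErrorOp f μ β + (κ : ℂ) • projFid β - (γ : ℂ) • projTrash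

/-! ### The parameters of the six-dimensional matrices -/

/-- The angle with `|θ| ≤ π/2` and `tan θ = e^{-2(μ-β²)} sinh(4βx)`. -/
def theta (μ β x : ℝ) : ℝ := Real.arctan (Real.exp (-2 * (μ - β ^ 2)) * Real.sinh (4 * β * x))

/-- The matrix elements of `h(x) P|x⟩⟨x|P'`, for an orthogonal projection `P`. -/
def sandwichForm (h : ℝ → ℝ) (P P' : ModeC →L[ℂ] ModeC) (x : ℝ) (φ ψ : ModeC) : ℂ :=
  (h x : ℂ) * (star ((P φ : ℝ → ℂ) x) * (P' ψ : ℝ → ℂ) x)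

/-- The matrix elements of the integrand of `M_oo`. -/
def formOO (f : ℝ → ℝ) (μ β : ℝ) : ℝ → ModeC → ModeC → ℂ :=
  sandwichForm (fun x => f x * (1 + Real.cos (theta μ β x))) projOdd projOdd

/-- The matrix elements of the integrand of `M_ee`. -/
def formEE (f : ℝ → ℝ) (μ β : ℝ) : ℝ → ModeC → ModeC → ℂ :=
  sandwichForm (fun x => f x * (1 - Real.cos (theta μ β x))) projEven projEven

/-- The matrix elements of the integrand of `M_{(+,o)(-,e)}`. -/
def formOE (f : ℝ → ℝ) (μ β : ℝ) : ℝ → ModeC → ModeC → ℂ :=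
  sandwichForm (fun x => f x * Real.sin (theta μ β x)) projOdd projEven

/-- The matrix elements of the integrand of `M_{(-,o)(+,e)}`. -/
def formOE' (f : ℝ → ℝ) (μ β : ℝ) : ℝ → ModeC → ModeC → ℂ :=
  sandwichForm (fun x => -f x * Real.sin (theta μ β x)) projOdd projEven

/-- `M_oo`. -/
def opOO (f : ℝ → ℝ) (μ β : ℝ) : ModeC →L[ℂ] ModeC := opIntegral (formOO f μ β)

/-- `M_ee`. -/
def opEE (f : ℝ → ℝ) (μ β : ℝ) : ModeC →L[ℂ] ModeC := opIntegral (formEE f μ β)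

/-- `M_{(+,o)(-,e)}`. -/
def opOE (f : ℝ → ℝ) (μ β : ℝ) : ModeC →L[ℂ] ModeC := opIntegral (formOE f μ β)

/-- `M_{(-,e)(+,o)}`. -/
def opEO (f : ℝ → ℝ) (μ β : ℝ) : ModeC →L[ℂ] ModeC := ContinuousLinearMap.adjoint (opOE f μ β)

/-- `M_{(-,o)(+,e)}`. -/
def opOE' (f : ℝ → ℝ) (μ β : ℝ) : ModeC →L[ℂ] ModeC := opIntegral (formOE' f μ β)

/-- `⟨β|T|β⟩`. -/
def braket (β : ℝ) (T : ModeC →L[ℂ] ModeC) : ℂ :=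
  inner ℂ (coherentState β) (T (coherentState β))

def coefO (β : ℝ) : ℝ := (braket β projOdd).re

def coefE (β : ℝ) : ℝ := (braket β projEven).re

def lamOO (f : ℝ → ℝ) (μ β : ℝ) : ℝ := (coefO β)⁻¹ * (braket β (opOO f μ β)).re

def lamEE (f : ℝ → ℝ) (μ β : ℝ) : ℝ := (coefE β)⁻¹ * (braket β (opEE f μ β)).re

def lamOE (f : ℝ → ℝ) (μ β : ℝ) : ℝ :=
  (Real.sqrt (coefO β * coefE β))⁻¹ * (braket β (opOE f μ β)).re

def sigOO (f : ℝ → ℝ) (μ β : ℝ) : ℝ :=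
  Real.sqrt ((coefO β)⁻¹ * ‖opOO f μ β (coherentState β)‖ ^ 2 - lamOO f μ β ^ 2)

def sigEO (f : ℝ → ℝ) (μ β : ℝ) : ℝ :=
  Real.sqrt ((coefO β)⁻¹ * ‖opEO f μ β (coherentState β)‖ ^ 2 - lamOE f μ β ^ 2)

/-- `σ_{(+,o)(-,e)}`. If `σ_oo = 0`, the bracket vanishes as well, and the value is `0`. -/
def sigOE (f : ℝ → ℝ) (μ β : ℝ) : ℝ :=
  (sigOO f μ β)⁻¹ *
    ((Real.sqrt (coefO β * coefE β))⁻¹ * (braket β (opOO f μ β ∘L opOE f μ β)).re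
      - lamOO f μ β * lamOE f μ β)

/-- `σ_{(-,e)(-,e)}`. If `σ_eo = 0`, the bracket vanishes as well, and the value is `0`. -/
def sigEE (f : ℝ → ℝ) (μ β : ℝ) : ℝ :=
  (sigEO f μ β)⁻¹ *
    ((Real.sqrt (coefO β * coefE β))⁻¹ * (braket β (opOE f μ β ∘L opEE f μ β)).re
      - lamOE f μ β * lamEE f μ β)

def delOE (f : ℝ → ℝ) (μ β : ℝ) : ℝ :=
  Real.sqrt ((coefE β)⁻¹ * ‖opOE f μ β (coherentState β)‖ ^ 2 - lamOE f μ β ^ 2 - sigOE f μ β ^ 2)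

def delEE (f : ℝ → ℝ) (μ β : ℝ) : ℝ :=
  Real.sqrt ((coefE β)⁻¹ * ‖opEE f μ β (coherentState β)‖ ^ 2 - lamEE f μ β ^ 2 - sigEE f μ β ^ 2)

/-- `M_6d⁽⁰⁾`. -/
def mat0 (f : ℝ → ℝ) (μ β κ γ : ℝ) : Matrix (Fin 6) (Fin 6) ℝ :=
  let Co := coefO β
  let Ce := coefE β
  let loo := lamOO f μ β
  let lee := lamEE f μ β
  let loe := lamOE f μ β
  let soo := sigOO f μ β
  let seo := sigEO f μ β
  let soe := sigOE f μ β
  let see := sigEE f μ β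
  let doe := delOE f μ β
  let dee := delEE f μ β
  let r := Real.sqrt (Co * Ce)
  !![1, 0, 0, doe, 0, 0;
     0, 1, soo, soe, 0, 0;
     0, soo, κ * Co + loo, κ * r + loe, seo, 0;
     doe, soe, κ * r + loe, κ * Ce + lee - γ, see, dee;
     0, 0, seo, see, 1 - γ, 0;
     0, 0, 0, dee, 0, 1 - γ]

/-- `M_6d⁽¹⁾`. -/
def mat1 (f : ℝ → ℝ) (μ β κ γ : ℝ) : Matrix (Fin 6) (Fin 6) ℝ :=
  let Co := coefO β
  let Ce := coefE β
  let loo := lamOO f μ β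
  let lee := lamEE f μ β
  let loe := lamOE f μ β
  let soo := sigOO f μ β
  let seo := sigEO f μ β
  let soe := sigOE f μ β
  let see := sigEE f μ β
  let doe := delOE f μ β
  let dee := delEE f μ β
  let r := Real.sqrt (Co * Ce)
  !![1 - γ, 0, 0, doe, 0, 0;
     0, 1 - γ, soo, -soe, 0, 0;
     0, soo, κ * Co + loo - γ, κ * r - loe, seo, 0;
     doe, -soe, κ * r - loe, κ * Ce + lee, -see, dee;
     0, 0, seo, -see, 1, 0;
     0, 0, 0, dee, 0, 1]

/-- The supremum of the spectrum of a matrix (for a symmetric one, its largest eigenvalue). -/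
def specSup (M : Matrix (Fin 6) (Fin 6) ℝ) : ℝ := sSup (spectrum ℝ M)

/-- `B^{hom}(κ,γ)`. -/
def boundB (f : ℝ → ℝ) (μ β κ γ : ℝ) : ℝ :=
  max (specSup (mat0 f μ β κ γ)) (specSup (mat1 f μ β κ γ))

end

end HomodyneQKD

open HomodyneQKD

/-!
The twisting operation is a reflection by the angle `θ(x)`, which is odd in `x`, so all operators
commute with `X_A ⊗ parity`. Each of the two eigenspaces of this symmetry is a copy of `L²(ℝ)`, on
which the phase error operator becomes `M_oo ± M_oe ± M_eo + M_ee = ∫ 2 f(x) |w(x)⟩⟨w(x)| dx` with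
`⟨w(x)| = cos(θ(x)/2) ⟨x| Π_od ± sin(θ(x)/2) ⟨x| Π_ev`. It is bounded by `1`, because `‖⟨w(x)|ψ⟩‖²`
is even in `x` and `f` has even part at most `1/2`. The fidelity term is the rank one operator of
`|β⟩`, and the trash term is one of the two parity projections.

The Gram–Schmidt process applied to the odd and even components of `|β⟩` and of their images yields
six vectors on which, up to the a priori bound, the operator is compressed to `M_6d`. Only the
columns of the two components of `|β⟩` have to be exact: on their orthogonal complement the
operator is dominated by `1` minus the trash term, which is diagonal in the six vectors, and the
orthogonal complement of all six is controlled by the diagonal entries of `M_6d`.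
-/

namespace HomodyneQKD

noncomputable section

/-! ### Completeness of the photon-number states -/

section Moments

open scoped FourierTransform SchwartzMap

variable {F : Type*} [NormedAddCommGroup F] [NormedSpace ℂ F]

theorem ae_eq_zero_of_fourier_eq_zero {V : Type*} [NormedAddCommGroup V] [InnerProductSpace ℝ V]
    [FiniteDimensional ℝ V] [MeasurableSpace V] [BorelSpace V] [CompleteSpace F] {f : V → F}
    (hf : Integrable f) (h : 𝓕 f = 0) : f =ᵐ[volume] 0 := by
  have hzero : Lp.toTemperedDistributionCLM F volume 1 (hf.toL1 f) = 0 := by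
    ext φ
    calc Lp.toTemperedDistributionCLM F volume 1 (hf.toL1 f) φ = ∫ x, 𝓕 (𝓕⁻ φ) x • f x := by
          rw [Lp.toTemperedDistributionCLM_apply, Lp.toTemperedDistribution_apply]
          refine integral_congr_ae ?_
          filter_upwards [hf.coeFn_toL1] with x hx
          rw [hx, FourierTransform.fourier_fourierInv_eq]
      _ = ∫ x, 𝓕⁻ φ x • 𝓕 f x := by
          simpa only [flip_innerₗ] using! VectorFourier.integral_fourierIntegral_smul_eq_flip
            (L := innerₗ V) Real.continuous_fourierChar continuous_inner
            ((𝓕⁻ φ).integrable (μ := volume)) hf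
      _ = 0 := by simp [h]
  have hL1 : hf.toL1 f = 0 :=
    LinearMap.ker_eq_bot'.1 Lp.ker_toTemperedDistributionCLM_eq_bot _ hzero
  exact (hf.toL1_eq_toL1_iff f 0 (integrable_zero V F volume)).1 hL1

theorem hasSum_cexp_smul (z : ℂ) (v : F) :
    HasSum (fun n : ℕ => (z ^ n / (n.factorial : ℂ)) • v) (Complex.exp z • v) := by
  rw [Complex.exp_eq_exp_ℂ]
  exact (NormedSpace.expSeries_div_hasSum_exp z).smul_const v

theorem hasSum_integral_pow_smul {f : ℝ → F}
    (hf : ∀ t : ℝ, Integrable fun x => Real.exp (t * |x|) • f x) (z : ℂ) :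
    HasSum (fun n : ℕ => (z ^ n / (n.factorial : ℂ)) • ∫ x : ℝ, x ^ n • f x)
      (∫ x : ℝ, Complex.exp (z * x) • f x) := by
  have hmeas : AEStronglyMeasurable f volume := by simpa using (hf 0).aestronglyMeasurable
  have hterm (n : ℕ) (x : ℝ) : (z ^ n / (n.factorial : ℂ)) • x ^ n • f x =
      ((z * x) ^ n / (n.factorial : ℂ)) • f x := by
    rw [← Complex.coe_smul, smul_smul]
    congr 1
    push_cast
    ring
  have hbound (x : ℝ) : HasSum (fun n : ℕ => (‖z‖ * |x|) ^ n / (n.factorial : ℝ) * ‖f x‖)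
      (Real.exp (‖z‖ * |x|) * ‖f x‖) := by
    rw [Real.exp_eq_exp_ℝ]
    exact (NormedSpace.expSeries_div_hasSum_exp (‖z‖ * |x|)).mul_right ‖f x‖
  simp_rw [← integral_smul]
  refine hasSum_integral_of_dominated_convergence
    (fun n x => (‖z‖ * |x|) ^ n / (n.factorial : ℝ) * ‖f x‖) (fun n => ?_)
    (fun n => .of_forall fun x => ?_) (.of_forall fun x => (hbound x).summable) ?_
    (.of_forall fun x => ?_)
  · exact ((continuous_pow n).aestronglyMeasurable.smul hmeas).const_smul _
  · rw [hterm, norm_smul]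
    simp
  · simp_rw [fun x => (hbound x).tsum_eq]
    refine (hf ‖z‖).norm.congr (.of_forall fun x => ?_)
    simp [norm_smul]
  · simpa only [hterm] using hasSum_cexp_smul (z * x) (f x)

/- The hypothesis makes the Fourier transform entire, and its Taylor coefficients at the origin are
multiples of the moments. -/
theorem ae_eq_zero_of_forall_integral_pow_smul_eq_zero [CompleteSpace F] {f : ℝ → F}
    (hf : ∀ t : ℝ, Integrable fun x => Real.exp (t * |x|) • f x)
    (h : ∀ n : ℕ, ∫ x : ℝ, x ^ n • f x = 0) : f =ᵐ[volume] 0 := by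
  refine ae_eq_zero_of_fourier_eq_zero (by simpa using hf 0) (funext fun w => ?_)
  have hsum := hasSum_integral_pow_smul hf (-2 * Real.pi * w * Complex.I)
  simp only [h, smul_zero] at hsum
  rw [Real.fourier_real_eq_integral_exp_smul, Pi.zero_apply, ← hsum.unique hasSum_zero]
  congr with x
  push_cast
  ring_nf

end Moments

theorem memLp_exp_mul_abs_mul_gaussian (t : ℝ) :
    MemLp (fun x : ℝ => Real.exp (t * |x|) * Real.exp (-x ^ 2)) 2 (volume : Measure ℝ) := by
  have hshift (s : ℝ) : MemLp (fun x : ℝ => Real.exp (s * x) * Real.exp (-x ^ 2)) 2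
      (volume : Measure ℝ) := by
    refine (((memLp_polynomial_mul_gaussian 1).comp_measurePreserving
      (measurePreserving_sub_right (volume : Measure ℝ) (s / 2))).const_mul
        (Real.exp (s ^ 2 / 4))).ae_eq (.of_forall fun x => ?_)
    simp only [Function.comp, Polynomial.eval_one, one_mul, ← Real.exp_add]
    ring_nf
  have hcont : Continuous fun x : ℝ => Real.exp (t * |x|) * Real.exp (-x ^ 2) := by fun_prop
  refine ((hshift t).add (hshift (-t))).mono hcont.aestronglyMeasurable (.of_forall fun x => ?_)
  rw [Pi.add_apply, ← add_mul, Real.norm_of_nonneg (by positivity),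
    Real.norm_of_nonneg (by positivity)]
  gcongr
  rcases abs_cases x with ⟨h, -⟩ | ⟨h, -⟩ <;> rw [h]
  · exact le_add_of_nonneg_right (Real.exp_pos _).le
  · rw [mul_neg, neg_mul]
    exact le_add_of_nonneg_left (Real.exp_pos _).le

/-- The pairing of `p(x) e^{-x²}` with `g`, as a linear functional of the polynomial `p`. -/
def gaussianPairing (g : ModeC) : Polynomial ℝ →ₗ[ℝ] ℂ where
  toFun p := ∫ x : ℝ, (p.eval x * Real.exp (-x ^ 2)) • g x
  map_add' p q := by
    have hint (p : Polynomial ℝ) : Integrable fun x : ℝ => (p.eval x * Real.exp (-x ^ 2)) • g x :=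
      memLp_one_iff_integrable.1 ((Lp.memLp g).smul (memLp_polynomial_mul_gaussian p))
    simp_rw [← integral_add (hint p) (hint q), Polynomial.eval_add, add_mul, add_smul]
  map_smul' a p := by
    simp_rw [Polynomial.eval_smul, smul_eq_mul, mul_assoc, mul_smul a, integral_smul,
      RingHom.id_apply]

/-- The polynomials `He_n(2x)` of the wave functions of the photon-number states. -/
def quadratureHermite : Polynomial.Sequence ℝ where
  elems' n := ((Polynomial.hermite n).map (Int.castRingHom ℝ)).comp (2 * Polynomial.X)
  degree_eq' n := by
    have hX : (2 * Polynomial.X : Polynomial ℝ).degree = 1 :=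
      Polynomial.degree_C_mul_X (two_ne_zero' ℝ)
    rw [Polynomial.degree_comp (by simp [hX]), hX, (Polynomial.hermite_monic n).degree_map,
      Polynomial.degree_hermite, mul_one]

theorem aeval_two_mul_hermite (n : ℕ) (x : ℝ) :
    Polynomial.aeval (2 * x) (Polynomial.hermite n) = (quadratureHermite n).eval x := by
  change _ = Polynomial.eval x (((Polynomial.hermite n).map _).comp (2 * Polynomial.X))
  rw [Polynomial.eval_comp, Polynomial.eval_map, Polynomial.eval_mul, Polynomial.eval_ofNat,
    Polynomial.eval_X, Polynomial.aeval_def]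
  rfl

theorem span_quadratureHermite : Submodule.span ℝ (Set.range quadratureHermite) = ⊤ :=
  quadratureHermite.span fun n =>
    (Polynomial.leadingCoeff_ne_zero.2 (quadratureHermite.ne_zero n)).isUnit

theorem inner_numberState (n : ℕ) (g : ModeC) :
    inner ℂ (numberState n) g = ((2 / Real.pi) ^ (1 / 4 : ℝ) / Real.sqrt (n.factorial : ℝ)) •
      gaussianPairing g (quadratureHermite n) := by
  rw [L2.inner_def, gaussianPairing, LinearMap.coe_mk, AddHom.coe_mk, ← integral_smul]
  refine integral_congr_ae ?_
  filter_upwards [(memLp_numberWave n).coeFn_toLp] with x hx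
  rw [numberState, hx, numberWave, aeval_two_mul_hermite, RCLike.inner_apply',
    Complex.conj_ofReal, smul_smul, Complex.real_smul]

theorem eq_zero_of_forall_inner_numberState {g : ModeC}
    (h : ∀ n, inner ℂ (numberState n) g = 0) : g = 0 := by
  have hpairing : gaussianPairing g = 0 :=
    LinearMap.ext_on_range span_quadratureHermite fun n => by
      have hn := h n
      rw [inner_numberState] at hn
      exact (smul_eq_zero.1 hn).resolve_left (by positivity)
  have hexp (t : ℝ) : Integrable fun x : ℝ => Real.exp (t * |x|) • Real.exp (-x ^ 2) • g x :=
    (memLp_one_iff_integrable.1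
      ((Lp.memLp g).smul (memLp_exp_mul_abs_mul_gaussian t))).congr
        (.of_forall fun x => mul_smul (Real.exp (t * |x|)) (Real.exp (-x ^ 2)) (g x))
  have hmoment (n : ℕ) : ∫ x : ℝ, x ^ n • Real.exp (-x ^ 2) • g x = 0 := by
    simpa [gaussianPairing, mul_smul] using LinearMap.congr_fun hpairing (Polynomial.X ^ n)
  refine (Lp.eq_zero_iff_ae_eq_zero).2 ?_
  filter_upwards [ae_eq_zero_of_forall_integral_pow_smul_eq_zero hexp hmoment] with x hx
  exact (smul_eq_zero.1 hx).resolve_left (Real.exp_pos _).ne'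

/-! ### Parity -/

section Involution

variable {𝕜 H : Type*} [RCLike 𝕜] [NormedAddCommGroup H] [InnerProductSpace 𝕜 H] {R : H →L[𝕜] H}

theorem starProjection_apply_of_involution (hsymm : (R : H →ₗ[𝕜] H).IsSymmetric)
    (hinv : Function.Involutive R) {K : Submodule 𝕜 H} [K.HasOrthogonalProjection]
    (hK : ∀ x, x ∈ K ↔ R x = x) (x : H) : K.starProjection x = (2⁻¹ : 𝕜) • (x + R x) := by
  refine Submodule.eq_starProjection_of_mem_of_inner_eq_zero ((hK _).2 ?_) fun w hw => ?_
  · rw [map_smul, map_add, hinv x, add_comm]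
  · have hw : inner 𝕜 (R x) w = inner 𝕜 x w := (hsymm x w).trans (by rw [R.coe_coe, (hK w).1 hw])
    have hcoef : x - (2⁻¹ : 𝕜) • (x + R x) = (2⁻¹ : 𝕜) • (x - R x) := by module
    rw [hcoef, inner_smul_left, inner_sub_left, hw, sub_self, mul_zero]

theorem mem_topologicalClosure_span_iff_of_involution [CompleteSpace H]
    (hsymm : (R : H →ₗ[𝕜] H).IsSymmetric) {S T : Set H} (hS : ∀ s ∈ S, R s = s)
    (hT : ∀ t ∈ T, R t = -t)
    (htotal : ∀ g, (∀ s ∈ S, inner 𝕜 s g = 0) → (∀ t ∈ T, inner 𝕜 t g = 0) → g = 0) (x : H) :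
    x ∈ (Submodule.span 𝕜 S).topologicalClosure ↔ R x = x := by
  set K := (Submodule.span 𝕜 S).topologicalClosure
  have hfixed {y : H} (hy : y ∈ K) : R y = y :=
    (Submodule.span 𝕜 S).topologicalClosure_minimal
      (t := LinearMap.eqLocus (R : H →ₗ[𝕜] H) LinearMap.id) (Submodule.span_le.2 hS)
      (isClosed_eq R.continuous continuous_id) hy
  refine ⟨hfixed, fun hx => ?_⟩
  have hres : x - K.starProjection x = 0 := by
    refine htotal _ (fun s hs => ?_) (fun t ht => ?_)
    · exact inner_eq_zero_symm.1 (K.starProjection_inner_eq_zero x s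
        (Submodule.le_topologicalClosure _ (Submodule.subset_span hs)))
    · have h := hsymm t (x - K.starProjection x)
      rw [R.coe_coe, map_sub, hx, hfixed (K.starProjection_apply_mem x), hT t ht,
        inner_neg_left] at h
      exact self_eq_neg.1 h.symm
  rw [sub_eq_zero.1 hres]
  exact K.starProjection_apply_mem x

end Involution

/-- The parity operator `ψ(x) ↦ ψ(-x)`. -/
def parity : ModeC →L[ℂ] ModeC :=
  (Lp.compMeasurePreservingₗᵢ ℂ (fun x : ℝ => -x)
    (Measure.measurePreserving_neg (volume : Measure ℝ))).toContinuousLinearMap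

theorem coeFn_parity (ψ : ModeC) : parity ψ =ᵐ[volume] fun x => ψ (-x) :=
  Lp.coeFn_compMeasurePreserving ψ (Measure.measurePreserving_neg (volume : Measure ℝ))

theorem ae_neg {p : ℝ → Prop} (h : ∀ᵐ x : ℝ, p x) : ∀ᵐ x : ℝ, p (-x) :=
  (Measure.measurePreserving_neg (volume : Measure ℝ)).quasiMeasurePreserving.ae h

theorem parity_involutive : Function.Involutive parity := fun ψ => by
  refine Lp.ext ?_
  filter_upwards [coeFn_parity (parity ψ), ae_neg (coeFn_parity ψ)] with x h1 h2
  rw [h1, h2, neg_neg]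

theorem isSymmetric_parity : (parity : ModeC →ₗ[ℂ] ModeC).IsSymmetric := fun φ ψ => by
  rw [L2.inner_def, L2.inner_def, ← integral_neg_eq_self]
  refine integral_congr_ae ?_
  filter_upwards [ae_neg (coeFn_parity φ), coeFn_parity ψ] with x h1 h2
  rw [parity.coe_coe, h1, h2, neg_neg]

theorem inner_parity_left (φ ψ : ModeC) : inner ℂ (parity φ) ψ = inner ℂ φ (parity ψ) :=
  isSymmetric_parity φ ψ

theorem numberWave_neg (n : ℕ) (x : ℝ) : numberWave n (-x) = (-1) ^ n * numberWave n x := by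
  have hhermite : Polynomial.aeval (-(2 * x)) (Polynomial.hermite n) =
      (-1) ^ n * Polynomial.aeval (2 * x) (Polynomial.hermite n) := by
    rw [Polynomial.aeval_eq_sum_range, Polynomial.aeval_eq_sum_range, Finset.mul_sum]
    refine Finset.sum_congr rfl fun k _ => ?_
    rcases Nat.even_or_odd (n + k) with h | h
    · rw [neg_pow, mul_smul_comm, neg_one_pow_congr (Nat.even_add.1 h)]
    · simp [Polynomial.coeff_hermite_of_odd_add h]
  rw [numberWave, numberWave, mul_neg, hhermite, neg_sq]
  ring

theorem parity_numberState (n : ℕ) : parity (numberState n) = (-1 : ℂ) ^ n • numberState n := by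
  refine Lp.ext ?_
  filter_upwards [coeFn_parity (numberState n), (memLp_numberWave n).coeFn_toLp,
    ae_neg (memLp_numberWave n).coeFn_toLp, Lp.coeFn_smul ((-1 : ℂ) ^ n) (numberState n)]
    with x h1 h2 h3 h4
  rw [h1, h4, Pi.smul_apply, numberState, h2, h3, numberWave_neg, smul_eq_mul]
  push_cast
  rfl

theorem parity_numberState_even (k : ℕ) :
    parity (numberState (2 * k)) = numberState (2 * k) := by
  rw [parity_numberState, (even_two_mul k).neg_one_pow, one_smul]

theorem parity_numberState_odd (k : ℕ) :
    parity (numberState (2 * k + 1)) = -numberState (2 * k + 1) := by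
  rw [parity_numberState, (odd_two_mul_add_one k).neg_one_pow, neg_one_smul]

theorem eq_zero_of_inner_even_odd {g : ModeC}
    (he : ∀ s ∈ Set.range fun k : ℕ => numberState (2 * k), inner ℂ s g = 0)
    (ho : ∀ s ∈ Set.range fun k : ℕ => numberState (2 * k + 1), inner ℂ s g = 0) : g = 0 :=
  eq_zero_of_forall_inner_numberState fun n => by
    rcases Nat.even_or_odd' n with ⟨k, rfl | rfl⟩
    · exact he _ ⟨k, rfl⟩
    · exact ho _ ⟨k, rfl⟩

theorem projEven_apply (ψ : ModeC) : projEven ψ = (2⁻¹ : ℂ) • (ψ + parity ψ) :=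
  starProjection_apply_of_involution isSymmetric_parity parity_involutive
    (mem_topologicalClosure_span_iff_of_involution isSymmetric_parity
      (Set.forall_mem_range.2 parity_numberState_even)
      (Set.forall_mem_range.2 parity_numberState_odd)
      fun _ => eq_zero_of_inner_even_odd) ψ

theorem projOdd_apply (ψ : ModeC) : projOdd ψ = (2⁻¹ : ℂ) • (ψ - parity ψ) := by
  have hsymm : ((-parity : ModeC →L[ℂ] ModeC) : ModeC →ₗ[ℂ] ModeC).IsSymmetric := fun φ ψ => by
    simpa using isSymmetric_parity φ ψ
  have hinv : Function.Involutive (-parity) := fun ψ => by simp [parity_involutive ψ]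
  rw [sub_eq_add_neg]
  exact starProjection_apply_of_involution hsymm hinv
    (mem_topologicalClosure_span_iff_of_involution hsymm
      (Set.forall_mem_range.2 fun k => by simp [parity_numberState_odd])
      (Set.forall_mem_range.2 fun k => by simp [parity_numberState_even])
      fun _ ho he => eq_zero_of_inner_even_odd he ho) ψ

theorem coeFn_projEven (ψ : ModeC) :
    projEven ψ =ᵐ[volume] fun x => (2⁻¹ : ℂ) * (ψ x + ψ (-x)) := by
  rw [projEven_apply]
  filter_upwards [Lp.coeFn_smul (2⁻¹ : ℂ) (ψ + parity ψ), Lp.coeFn_add ψ (parity ψ),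
    coeFn_parity ψ] with x h1 h2 h3
  rw [h1, Pi.smul_apply, h2, Pi.add_apply, h3, smul_eq_mul]

theorem coeFn_projOdd (ψ : ModeC) :
    projOdd ψ =ᵐ[volume] fun x => (2⁻¹ : ℂ) * (ψ x - ψ (-x)) := by
  rw [projOdd_apply]
  filter_upwards [Lp.coeFn_smul (2⁻¹ : ℂ) (ψ - parity ψ), Lp.coeFn_sub ψ (parity ψ),
    coeFn_parity ψ] with x h1 h2 h3
  rw [h1, Pi.smul_apply, h2, Pi.sub_apply, h3, smul_eq_mul]

theorem isStarProjection_projOdd : IsStarProjection projOdd := isStarProjection_starProjection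

theorem isStarProjection_projEven : IsStarProjection projEven := isStarProjection_starProjection

theorem projEven_eq_one_sub : projEven = 1 - projOdd := by
  ext1 ψ
  rw [sub_apply, one_apply_eq_self, projEven_apply, projOdd_apply]
  module

theorem projOdd_mul_projEven : projOdd * projEven = 0 := by
  rw [projEven_eq_one_sub, isStarProjection_projOdd.isIdempotentElem.mul_one_sub_self]

theorem projEven_mul_projOdd : projEven * projOdd = 0 := by
  rw [projEven_eq_one_sub, isStarProjection_projOdd.isIdempotentElem.one_sub_mul_self]

/-! ### Coherent states -/

theorem parity_coherentState (b : ℝ) : parity (coherentState b) = coherentState (-b) := by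
  refine Lp.ext ?_
  filter_upwards [coeFn_parity (coherentState b), (memLp_coherentWave (-b)).coeFn_toLp,
    ae_neg (memLp_coherentWave b).coeFn_toLp] with x h1 h2 h3
  rw [h1, coherentState, coherentState, h2, h3, coherentWave, coherentWave]
  congr 4
  ring

theorem integral_coherentWave_mul_coherentWave (a b : ℝ) :
    ∫ x : ℝ, coherentWave a x * coherentWave b x = Real.exp (-(a - b) ^ 2 / 2) := by
  have hpi : 0 < 2 / Real.pi := by positivity
  have hconst : ((2 / Real.pi) ^ (1 / 4 : ℝ)) * ((2 / Real.pi) ^ (1 / 4 : ℝ)) =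
      Real.sqrt (2 / Real.pi) := by
    rw [← Real.rpow_add hpi, Real.sqrt_eq_rpow]
    norm_num
  have hprod (x : ℝ) : coherentWave a x * coherentWave b x = Real.sqrt (2 / Real.pi) *
      Real.exp (-(a - b) ^ 2 / 2) * Real.exp (-2 * (x - (a + b) / 2) ^ 2) := by
    rw [coherentWave, coherentWave, mul_mul_mul_comm, hconst, mul_assoc, ← Real.exp_add,
      ← Real.exp_add]
    congr 2
    ring
  simp only [hprod]
  rw [integral_const_mul, integral_sub_right_eq_self (fun x => Real.exp (-2 * x ^ 2)),
    integral_gaussian, mul_right_comm, ← Real.sqrt_mul hpi.le, div_mul_div_cancel₀ Real.pi_ne_zero,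
    div_self two_ne_zero, Real.sqrt_one, one_mul]

theorem inner_coherentState (a b : ℝ) :
    inner ℂ (coherentState a) (coherentState b) = (Real.exp (-(a - b) ^ 2 / 2) : ℂ) := by
  rw [L2.inner_def, ← integral_coherentWave_mul_coherentWave, ← integral_complex_ofReal]
  refine integral_congr_ae ?_
  filter_upwards [(memLp_coherentWave a).coeFn_toLp, (memLp_coherentWave b).coeFn_toLp]
    with x ha hb
  rw [coherentState, coherentState, ha, hb, RCLike.inner_apply', Complex.conj_ofReal,
    Complex.ofReal_mul]

theorem inner_coherentState_self (β : ℝ) :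
    inner ℂ (coherentState β) (coherentState β) = (Real.exp (-β ^ 2) * Real.exp (β ^ 2) : ℂ) := by
  rw [inner_coherentState, ← Complex.ofReal_mul, ← Real.exp_add]
  simp

theorem inner_coherentState_neg (β : ℝ) :
    inner ℂ (coherentState β) (coherentState (-β)) =
      (Real.exp (-β ^ 2) * Real.exp (-β ^ 2) : ℂ) := by
  rw [inner_coherentState, ← Complex.ofReal_mul, ← Real.exp_add]
  congr 2
  ring

theorem braket_projOdd (β : ℝ) :
    braket β projOdd = ((Real.exp (-β ^ 2) * Real.sinh (β ^ 2) : ℝ) : ℂ) := by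
  rw [braket, projOdd_apply, parity_coherentState, inner_smul_right, inner_sub_right,
    inner_coherentState_self, inner_coherentState_neg, Real.sinh_eq]
  push_cast
  ring

theorem braket_projEven (β : ℝ) :
    braket β projEven = ((Real.exp (-β ^ 2) * Real.cosh (β ^ 2) : ℝ) : ℂ) := by
  rw [braket, projEven_apply, parity_coherentState, inner_smul_right, inner_add_right,
    inner_coherentState_self, inner_coherentState_neg, Real.cosh_eq]
  push_cast
  ring

theorem coefO_pos {β : ℝ} (hβ : β ≠ 0) : 0 < coefO β := by
  rw [coefO, braket_projOdd, Complex.ofReal_re]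
  exact mul_pos (Real.exp_pos _) (Real.sinh_pos_iff.2 (by positivity))

theorem coefE_pos (β : ℝ) : 0 < coefE β := by
  rw [coefE, braket_projEven, Complex.ofReal_re]
  exact mul_pos (Real.exp_pos _) (Real.cosh_pos _)

theorem norm_sq_apply_of_isStarProjection {𝕜 H : Type*} [RCLike 𝕜] [NormedAddCommGroup H]
    [InnerProductSpace 𝕜 H] [CompleteSpace H] {P : H →L[𝕜] H} (hP : IsStarProjection P) (x : H) :
    ‖P x‖ ^ 2 = RCLike.re (inner 𝕜 x (P x)) := by
  calc ‖P x‖ ^ 2 = RCLike.re (inner 𝕜 (P x) (P x)) := (inner_self_eq_norm_sq _).symm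
    _ = RCLike.re (inner 𝕜 x ((P * P) x)) :=
      congrArg _ (hP.isSelfAdjoint.isSymmetric x (P x))
    _ = RCLike.re (inner 𝕜 x (P x)) := by rw [hP.isIdempotentElem]

theorem norm_sq_projOdd_coherentState (β : ℝ) : ‖projOdd (coherentState β)‖ ^ 2 = coefO β :=
  norm_sq_apply_of_isStarProjection isStarProjection_projOdd _

theorem norm_sq_projEven_coherentState (β : ℝ) : ‖projEven (coherentState β)‖ ^ 2 = coefE β :=
  norm_sq_apply_of_isStarProjection isStarProjection_projEven _

/-! ### Weak integrals -/

namespace IsOpIntegral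

variable {H : Type*} [NormedAddCommGroup H] [InnerProductSpace ℂ H]
  {Q Q' : ℝ → H → H → ℂ} {M M' : H →L[ℂ] H}

theorem unique (h : IsOpIntegral Q M) (h' : IsOpIntegral Q M') : M = M' :=
  ContinuousLinearMap.ext fun ψ => ext_inner_left ℂ fun φ => by
    rw [(h φ ψ).2, (h' φ ψ).2]

theorem opIntegral_eq (h : IsOpIntegral Q M) : opIntegral Q = M := by
  have hex : ∃ M, IsOpIntegral Q M := ⟨M, h⟩
  rw [opIntegral, dif_pos hex]
  exact hex.choose_spec.unique h

theorem congr_ae (h : IsOpIntegral Q M) (hQ : ∀ φ ψ, ∀ᵐ x, Q x φ ψ = Q' x φ ψ) :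
    IsOpIntegral Q' M := fun φ ψ =>
  ⟨(h φ ψ).1.congr (hQ φ ψ), by rw [(h φ ψ).2, integral_congr_ae (hQ φ ψ)]⟩

theorem add (h : IsOpIntegral Q M) (h' : IsOpIntegral Q' M') :
    IsOpIntegral (fun x φ ψ => Q x φ ψ + Q' x φ ψ) (M + M') := fun φ ψ =>
  ⟨(h φ ψ).1.add (h' φ ψ).1, by
    rw [add_apply, inner_add_right, (h φ ψ).2, (h' φ ψ).2, integral_add (h φ ψ).1 (h' φ ψ).1]⟩

theorem const_mul (c : ℂ) (h : IsOpIntegral Q M) :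
    IsOpIntegral (fun x φ ψ => c * Q x φ ψ) (c • M) := fun φ ψ =>
  ⟨(h φ ψ).1.const_mul c, by
    rw [smul_apply, inner_smul_right, (h φ ψ).2, integral_const_mul]⟩

theorem adjoint [CompleteSpace H] (h : IsOpIntegral Q M) :
    IsOpIntegral (fun x φ ψ => star (Q x ψ φ)) (ContinuousLinearMap.adjoint M) := fun φ ψ =>
  ⟨(Complex.conjCLE : ℂ →L[ℝ] ℂ).integrable_comp (h ψ φ).1, by
    rw [ContinuousLinearMap.adjoint_inner_right, ← inner_conj_symm, (h ψ φ).2]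
    exact integral_conj.symm⟩

theorem adjoint_comp_comp [CompleteSpace H] {K : Type*} [NormedAddCommGroup K]
    [InnerProductSpace ℂ K] [CompleteSpace K] (h : IsOpIntegral Q M) (S : K →L[ℂ] H) :
    IsOpIntegral (fun x φ ψ => Q x (S φ) (S ψ))
      (ContinuousLinearMap.adjoint S ∘L M ∘L S) := fun φ ψ =>
  ⟨(h (S φ) (S ψ)).1, by
    rw [← (h (S φ) (S ψ)).2, ContinuousLinearMap.comp_apply, ContinuousLinearMap.comp_apply,
      ContinuousLinearMap.adjoint_inner_right]⟩

end IsOpIntegral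

/-! ### Multiplication operators -/

section Multiplication

variable {h : ℝ → ℝ} (hh : MemLp h ⊤ (volume : Measure ℝ))

/-- Multiplication of wave functions by an essentially bounded real function. -/
def mulOp : ModeC →L[ℂ] ModeC :=
  (ContinuousLinearMap.mul ℂ ℂ).holderL volume ⊤ 2 2
    ((hh.ofReal : MemLp (fun x => (h x : ℂ)) ⊤ volume).toLp _)

theorem coeFn_mulOp (ψ : ModeC) : mulOp hh ψ =ᵐ[volume] fun x => (h x : ℂ) * ψ x := by
  have hh' : MemLp (fun x => (h x : ℂ)) ⊤ (volume : Measure ℝ) := hh.ofReal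
  filter_upwards [(ContinuousLinearMap.mul ℂ ℂ).coeFn_holder (r := 2) (hh'.toLp _) ψ,
    hh'.coeFn_toLp] with x hx hcoe
  rw [hcoe] at hx
  exact hx

theorem inner_mulOp_ae (φ ψ : ModeC) :
    (fun x => inner ℂ ((φ : ℝ → ℂ) x) ((mulOp hh ψ : ℝ → ℂ) x)) =ᵐ[volume]
      fun x => (h x : ℂ) * (star ((φ : ℝ → ℂ) x) * (ψ : ℝ → ℂ) x) := by
  filter_upwards [coeFn_mulOp hh ψ] with x hx
  rw [hx, RCLike.inner_apply', starRingEnd_apply, mul_left_comm]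

theorem isSelfAdjoint_mulOp : IsSelfAdjoint (mulOp hh) := by
  refine ContinuousLinearMap.isSelfAdjoint_iff_isSymmetric.2 fun φ ψ => ?_
  rw [L2.inner_def, L2.inner_def]
  refine integral_congr_ae ?_
  filter_upwards [coeFn_mulOp hh φ, coeFn_mulOp hh ψ] with x hφ hψ
  rw [ContinuousLinearMap.coe_coe, hφ, hψ, RCLike.inner_apply', RCLike.inner_apply', map_mul,
    Complex.conj_ofReal, mul_left_comm, mul_assoc]

theorem isOpIntegral_sandwichForm {P : ModeC →L[ℂ] ModeC} (hP : IsSelfAdjoint P)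
    (P' : ModeC →L[ℂ] ModeC) : IsOpIntegral (sandwichForm h P P') (P * mulOp hh * P') :=
  fun φ ψ => by
    have hae := inner_mulOp_ae hh (P φ) (P' ψ)
    refine ⟨(L2.integrable_inner (𝕜 := ℂ) (P φ) (mulOp hh (P' ψ))).congr hae, ?_⟩
    rw [← integral_congr_ae (g := fun x => sandwichForm h P P' x φ ψ) hae, ← L2.inner_def]
    exact (hP.isSymmetric φ _).symm

end Multiplication

/-! ### Real wave functions -/

/-- The vectors with a real wave function, between which all matrix elements of the claim are
taken. -/
def IsRealWave (ψ : ModeC) : Prop := ∀ᵐ x, ((ψ : ℝ → ℂ) x).im = 0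

theorem isRealWave_coherentState (b : ℝ) : IsRealWave (coherentState b) := by
  filter_upwards [(memLp_coherentWave b).coeFn_toLp] with x hx
  rw [coherentState, hx, Complex.ofReal_im]

namespace IsRealWave

variable {φ ψ : ModeC}

theorem mulOp (hψ : IsRealWave ψ) {h : ℝ → ℝ} (hh : MemLp h ⊤ (volume : Measure ℝ)) :
    IsRealWave (mulOp hh ψ) := by
  filter_upwards [coeFn_mulOp hh ψ, hψ] with x hx hψx
  rw [hx, Complex.im_ofReal_mul, hψx, mul_zero]

theorem projOdd (hψ : IsRealWave ψ) : IsRealWave (projOdd ψ) := by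
  filter_upwards [coeFn_projOdd ψ, hψ, ae_neg hψ] with x hx hψx hψnx
  simp [hx, hψx, hψnx]

theorem projEven (hψ : IsRealWave ψ) : IsRealWave (projEven ψ) := by
  filter_upwards [coeFn_projEven ψ, hψ, ae_neg hψ] with x hx hψx hψnx
  simp [hx, hψx, hψnx]

theorem inner_im (hφ : IsRealWave φ) (hψ : IsRealWave ψ) : (inner ℂ φ ψ).im = 0 := by
  rw [L2.inner_def, ← RCLike.im_eq_complex_im, ← integral_im (L2.integrable_inner (𝕜 := ℂ) φ ψ)]
  refine integral_eq_zero_of_ae ?_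
  filter_upwards [hφ, hψ] with x hφx hψx
  simp [RCLike.inner_apply, hφx, hψx]

end IsRealWave

/-! ### The blocks of the phase error operator -/

section Blocks

theorem measurable_theta (μ β : ℝ) : Measurable (theta μ β) := by
  unfold theta
  fun_prop

theorem memLp_top_comp_theta {g : ℝ → ℝ} (hg : Measurable g) {C : ℝ} (hC : ∀ t, |g t| ≤ C)
    (μ β : ℝ) : MemLp (fun x => g (theta μ β x)) ⊤ (volume : Measure ℝ) :=
  memLp_top_of_bound (hg.comp (measurable_theta μ β)).aestronglyMeasurable C
    (.of_forall fun _ => hC _)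

variable {f : ℝ → ℝ} (hf : MemLp f ⊤ (volume : Measure ℝ)) (μ β : ℝ)
include hf

theorem memLp_weightOO :
    MemLp (fun x => f x * (1 + Real.cos (theta μ β x))) ⊤ (volume : Measure ℝ) :=
  (memLp_top_comp_theta (g := fun t => 1 + Real.cos t) (by fun_prop) (C := 2) (fun t => abs_le.2
    ⟨by linarith [Real.neg_one_le_cos t], by linarith [Real.cos_le_one t]⟩) μ β).mul hf

theorem memLp_weightEE :
    MemLp (fun x => f x * (1 - Real.cos (theta μ β x))) ⊤ (volume : Measure ℝ) :=
  (memLp_top_comp_theta (g := fun t => 1 - Real.cos t) (by fun_prop) (C := 2) (fun t => abs_le.2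
    ⟨by linarith [Real.cos_le_one t], by linarith [Real.neg_one_le_cos t]⟩) μ β).mul hf

theorem memLp_weightOE :
    MemLp (fun x => f x * Real.sin (theta μ β x)) ⊤ (volume : Measure ℝ) :=
  (memLp_top_comp_theta Real.measurable_sin Real.abs_sin_le_one μ β).mul hf

theorem opOO_eq : opOO f μ β = projOdd * mulOp (memLp_weightOO hf μ β) * projOdd :=
  (isOpIntegral_sandwichForm (memLp_weightOO hf μ β)
    isStarProjection_projOdd.isSelfAdjoint projOdd).opIntegral_eq

theorem opEE_eq : opEE f μ β = projEven * mulOp (memLp_weightEE hf μ β) * projEven :=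
  (isOpIntegral_sandwichForm (memLp_weightEE hf μ β)
    isStarProjection_projEven.isSelfAdjoint projEven).opIntegral_eq

theorem opOE_eq : opOE f μ β = projOdd * mulOp (memLp_weightOE hf μ β) * projEven :=
  (isOpIntegral_sandwichForm (memLp_weightOE hf μ β)
    isStarProjection_projOdd.isSelfAdjoint projEven).opIntegral_eq

theorem isOpIntegral_opOO : IsOpIntegral (formOO f μ β) (opOO f μ β) :=
  opOO_eq hf μ β ▸ isOpIntegral_sandwichForm _ isStarProjection_projOdd.isSelfAdjoint projOdd

theorem isOpIntegral_opEE : IsOpIntegral (formEE f μ β) (opEE f μ β) :=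
  opEE_eq hf μ β ▸ isOpIntegral_sandwichForm _ isStarProjection_projEven.isSelfAdjoint projEven

theorem isOpIntegral_opOE : IsOpIntegral (formOE f μ β) (opOE f μ β) :=
  opOE_eq hf μ β ▸ isOpIntegral_sandwichForm _ isStarProjection_projOdd.isSelfAdjoint projEven

theorem isOpIntegral_neg_opOE : IsOpIntegral (formOE' f μ β) (-opOE f μ β) := by
  rw [← neg_one_smul ℂ]
  refine ((isOpIntegral_opOE hf μ β).const_mul (-1)).congr_ae fun φ ψ => .of_forall fun x => ?_
  simp only [formOE, formOE', sandwichForm]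
  push_cast
  ring

theorem isSelfAdjoint_opOO : IsSelfAdjoint (opOO f μ β) := by
  rw [opOO_eq hf]
  exact (isSelfAdjoint_mulOp _).conjugate_self isStarProjection_projOdd.isSelfAdjoint

theorem isSelfAdjoint_opEE : IsSelfAdjoint (opEE f μ β) := by
  rw [opEE_eq hf]
  exact (isSelfAdjoint_mulOp _).conjugate_self isStarProjection_projEven.isSelfAdjoint

variable {φ : ModeC} (hφ : IsRealWave φ)
include hφ

theorem isRealWave_opOO : IsRealWave (opOO f μ β φ) := by
  rw [opOO_eq hf]
  exact (hφ.projOdd.mulOp (memLp_weightOO hf μ β)).projOdd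

theorem isRealWave_opEE : IsRealWave (opEE f μ β φ) := by
  rw [opEE_eq hf]
  exact (hφ.projEven.mulOp (memLp_weightEE hf μ β)).projEven

theorem isRealWave_opOE : IsRealWave (opOE f μ β φ) := by
  rw [opOE_eq hf]
  exact (hφ.projEven.mulOp (memLp_weightOE hf μ β)).projOdd

end Blocks

/-! ### The twisting operation -/

section Involution

variable {A : Type*} [Ring A] [Algebra ℝ A] {W : A}

theorem spectrum_subset_of_mul_self_eq_one (hW : W * W = 1) : spectrum ℝ W ⊆ {1, -1} := by
  intro x hx
  rcases subsingleton_or_nontrivial A with hA | hA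
  · simp [spectrum.of_subsingleton] at hx
  · have hsq := spectrum.pow_mem_pow W 2 hx
    rwa [sq W, hW, spectrum.one_eq, Set.mem_singleton_iff, sq_eq_one_iff] at hsq

theorem cfc_sign_add_smul_of_mul_self_eq_one [StarRing A] [TopologicalSpace A]
    [ContinuousFunctionalCalculus ℝ A IsSelfAdjoint] [ContinuousMap.UniqueHom ℝ A]
    (hW : IsSelfAdjoint W) (hW1 : W * W = 1) {s t : ℝ} (hts : |t| < s) :
    cfc Real.sign (t • 1 + s • W) = W := by
  have hsub := spectrum_subset_of_mul_self_eq_one hW1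
  have hfin : (spectrum ℝ W).Finite := (Set.toFinite _).subset hsub
  have haffine : t • 1 + s • W = cfc (fun x => t + s * x) W := by
    rw [cfc_const_add t (fun x => s * x) W, cfc_const_mul_id s W, Algebra.algebraMap_eq_smul_one]
  obtain ⟨hneg, hpos⟩ := abs_lt.1 hts
  rw [haffine, ← cfc_comp' Real.sign _ W ((hfin.image _).continuousOn _)]
  refine (cfc_congr fun x hx => ?_).trans (cfc_id ℝ W)
  rcases hsub hx with rfl | rfl
  · exact Real.sign_of_pos (by linarith)
  · exact Real.sign_of_neg (by linarith)

end Involution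

/-- The reflection `sin θ Z + cos θ X`. -/
def reflection (θ : ℝ) : Matrix (Fin 2) (Fin 2) ℂ :=
  !![(Real.sin θ : ℂ), (Real.cos θ : ℂ); (Real.cos θ : ℂ), -(Real.sin θ : ℂ)]

theorem reflection_mul_self (θ : ℝ) : reflection θ * reflection θ = 1 := by
  have h := Complex.sin_sq_add_cos_sq θ
  rw [reflection, Matrix.mul_fin_two, Matrix.one_fin_two]
  push_cast
  ext i j
  fin_cases i <;> fin_cases j <;> simp <;> grind

theorem isSelfAdjoint_reflection (θ : ℝ) : IsSelfAdjoint (reflection θ) := by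
  ext i j
  fin_cases i <;> fin_cases j <;>
    simp [reflection, Matrix.star_apply, -Complex.ofReal_cos, -Complex.ofReal_sin]

theorem dyad_ket0 : dyad ket0 = !![1, 0; 0, 0] := by
  ext i j
  fin_cases i <;> fin_cases j <;> simp [dyad, ket0, Matrix.vecMulVec]

theorem dyad_ket1 : dyad ket1 = !![0, 0; 0, 1] := by
  ext i j
  fin_cases i <;> fin_cases j <;> simp [dyad, ket1, Matrix.vecMulVec]

theorem sqrt_two_inv_mul_self : ((Real.sqrt 2 : ℂ))⁻¹ * ((Real.sqrt 2 : ℂ))⁻¹ = 2⁻¹ := by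
  rw [← mul_inv, ← Complex.ofReal_mul, Real.mul_self_sqrt zero_le_two, Complex.ofReal_ofNat]

theorem dyad_ketPlus : dyad ketPlus = !![2⁻¹, 2⁻¹; 2⁻¹, 2⁻¹] := by
  ext i j
  fin_cases i <;> fin_cases j <;>
    simp [dyad, ketPlus, Matrix.vecMulVec, -mul_inv_rev, sqrt_two_inv_mul_self]

theorem dyad_ketMinus : dyad ketMinus = !![2⁻¹, -2⁻¹; -2⁻¹, 2⁻¹] := by
  ext i j
  fin_cases i <;> fin_cases j <;>
    simp [dyad, ketMinus, Matrix.vecMulVec, -mul_inv_rev, sqrt_two_inv_mul_self]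

theorem sqrt_gaussianPDFReal_quarter (m x : ℝ) :
    Real.sqrt (ProbabilityTheory.gaussianPDFReal m (1 / 4) x) =
      Real.sqrt ((Real.sqrt (2 * Real.pi * (1 / 4)))⁻¹) * Real.exp (-(x - m) ^ 2) := by
  rw [ProbabilityTheory.gaussianPDFReal_def, Real.sqrt_mul (by positivity)]
  congr 1
  rw [Real.sqrt_eq_iff_mul_self_eq (Real.exp_pos _).le (Real.exp_pos _).le, ← Real.exp_add]
  push_cast
  ring_nf

theorem exists_pos_sqrt_gaussianPDFReal_eq (β x : ℝ) : ∃ w : ℝ, 0 < w ∧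
    Real.sqrt (ProbabilityTheory.gaussianPDFReal β (1 / 4) x) = w * Real.exp (2 * β * x) ∧
    Real.sqrt (ProbabilityTheory.gaussianPDFReal (-β) (1 / 4) x) = w * Real.exp (-(2 * β * x)) := by
  refine ⟨Real.sqrt ((Real.sqrt (2 * Real.pi * (1 / 4)))⁻¹) * Real.exp (-(x ^ 2 + β ^ 2)),
    by positivity, ?_, ?_⟩ <;>
  · rw [sqrt_gaussianPDFReal_quarter, mul_assoc _ (Real.exp _), ← Real.exp_add]
    ring_nf

theorem tauHom01_eq (μ β x : ℝ) {a b : ℝ}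
    (ha : Real.sqrt (ProbabilityTheory.gaussianPDFReal β (1 / 4) x) = a)
    (hb : Real.sqrt (ProbabilityTheory.gaussianPDFReal (-β) (1 / 4) x) = b) :
    tauHom01 μ β x = !![((Real.exp (-2 * (μ - β ^ 2)) * a ^ 2 / 2 : ℝ) : ℂ), ((a * b / 2 : ℝ) : ℂ);
      ((a * b / 2 : ℝ) : ℂ), ((Real.exp (-2 * (μ - β ^ 2)) * b ^ 2 / 2 : ℝ) : ℂ)] := by
  subst ha hb
  ext i j
  simp only [tauHom01, tauHom, qParam, dyad_ketPlus, dyad_ketMinus]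
  fin_cases i <;> fin_cases j <;> simp [dyad, gaussVec, Matrix.vecMulVec] <;> ring

theorem exists_tauHom01_eq_smul_one_add_smul_reflection (μ β x : ℝ) : ∃ w : ℝ, 0 < w ∧
    tauHom01 μ β x =
      (w * (Real.exp (-2 * (μ - β ^ 2)) * Real.cosh (4 * β * x))) • 1 +
        (w * (Real.cos (theta μ β x))⁻¹) • reflection (theta μ β x) := by
  obtain ⟨w, hw, hw0, hw1⟩ := exists_pos_sqrt_gaussianPDFReal_eq β x
  refine ⟨w ^ 2 / 2, by positivity, ?_⟩
  have hcos : Real.cos (theta μ β x) ≠ 0 := (Real.cos_arctan_pos _).ne'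
  have hsin : (Real.cos (theta μ β x))⁻¹ * Real.sin (theta μ β x) =
      Real.exp (-2 * (μ - β ^ 2)) * Real.sinh (4 * β * x) := by
    rw [inv_mul_eq_div, ← Real.tan_eq_sin_div_cos, theta, Real.tan_arctan]
  have hexp : Real.exp (2 * β * x) * Real.exp (-(2 * β * x)) = 1 := by
    rw [← Real.exp_add, add_neg_cancel, Real.exp_zero]
  have hexp_sq : Real.exp (4 * β * x) = Real.exp (2 * β * x) ^ 2 ∧
      Real.exp (-(4 * β * x)) = Real.exp (-(2 * β * x)) ^ 2 := by
    constructor <;> rw [← Real.exp_nat_mul] <;> ring_nf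
  rw [Real.sinh_eq, hexp_sq.1, hexp_sq.2] at hsin
  rw [tauHom01_eq μ β x hw0 hw1, Real.cosh_eq, hexp_sq.1, hexp_sq.2]
  generalize Real.exp (-2 * (μ - β ^ 2)) = r at *
  ext i j
  fin_cases i <;> fin_cases j <;>
    simp only [reflection, Matrix.add_apply, Matrix.smul_apply, Complex.real_smul, Fin.zero_eta,
      Fin.mk_one, Matrix.of_apply, Matrix.cons_val', Matrix.cons_val_zero, Matrix.cons_val_one,
      Matrix.cons_val_fin_one, Matrix.one_apply, one_ne_zero, zero_ne_one, if_true, if_false,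
      mul_one, mul_zero, zero_add] <;>
    norm_cast
  · linear_combination (-(w ^ 2 / 2)) * hsin
  · rw [inv_mul_cancel_right₀ hcos]
    linear_combination (w ^ 2 / 2) * hexp
  · rw [inv_mul_cancel_right₀ hcos]
    linear_combination (w ^ 2 / 2) * hexp
  · linear_combination (w ^ 2 / 2) * hsin

theorem exp_mul_cosh_lt_inv_cos_theta {μ β : ℝ} (hβμ : β ^ 2 < μ) (x : ℝ) :
    Real.exp (-2 * (μ - β ^ 2)) * Real.cosh (4 * β * x) < (Real.cos (theta μ β x))⁻¹ := by
  have hr : Real.exp (-2 * (μ - β ^ 2)) ^ 2 < 1 :=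
    pow_lt_one₀ (Real.exp_pos _).le (Real.exp_lt_one_iff.2 (by linarith)) two_ne_zero
  rw [theta, Real.cos_arctan, one_div, inv_inv]
  refine Real.lt_sqrt_of_sq_lt ?_
  rw [mul_pow, mul_pow, Real.cosh_sq]
  linarith

theorem twistW_eq {μ β : ℝ} (hβμ : β ^ 2 < μ) (x : ℝ) :
    twistW μ β x = reflection (theta μ β x) := by
  obtain ⟨w, hw, htau⟩ := exists_tauHom01_eq_smul_one_add_smul_reflection μ β x
  rw [twistW, htau]
  refine cfc_sign_add_smul_of_mul_self_eq_one (isSelfAdjoint_reflection _)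
    (reflection_mul_self _) ?_
  rw [abs_of_nonneg (by positivity [Real.cosh_pos (4 * β * x)])]
  exact mul_lt_mul_of_pos_left (exp_mul_cosh_lt_inv_cos_theta hβμ x) hw

theorem twistV_mulVec {μ β : ℝ} (hβμ : β ^ 2 < μ) (x : ℝ) (v : Fin 2 × Fin 2 → ℂ) :
    twistV μ β x *ᵥ v = fun ab => !![v (0, 0), Real.cos (theta μ β x) * v (0, 1) +
        Real.sin (theta μ β x) * v (1, 1);
      v (1, 0), -Real.sin (theta μ β x) * v (0, 1) + Real.cos (theta μ β x) * v (1, 1)]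
      ab.1 ab.2 := by
  rw [twistV, twistW_eq hβμ, ← Matrix.mulVec_mulVec]
  have h1 : cnotBA *ᵥ v = fun ab => !![v (0, 0), v (1, 1); v (1, 0), v (0, 1)] ab.1 ab.2 := by
    ext ⟨a, b⟩
    fin_cases a <;> fin_cases b <;>
      simp [cnotBA, Matrix.mulVec, dotProduct, Fintype.sum_prod_type, Fin.sum_univ_two, dyad_ket0,
        dyad_ket1, pauliX, Matrix.one_apply]
  rw [h1]
  ext ⟨a, b⟩
  fin_cases a <;> fin_cases b <;>
    simp [Matrix.mulVec, dotProduct, Fintype.sum_prod_type, Fin.sum_univ_two, dyad_ket0,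
        dyad_ket1, reflection, Matrix.one_apply, -Complex.ofReal_cos, -Complex.ofReal_sin] <;> ring

theorem one_kronecker_dyad_ketMinus_form (v w : Fin 2 × Fin 2 → ℂ) :
    star v ⬝ᵥ (((1 : Matrix (Fin 2) (Fin 2) ℂ) ⊗ₖ dyad ketMinus) *ᵥ w) =
      2⁻¹ * (star (v (0, 0) - v (0, 1)) * (w (0, 0) - w (0, 1)) +
        star (v (1, 0) - v (1, 1)) * (w (1, 0) - w (1, 1))) := by
  simp only [dotProduct, Pi.star_apply, RCLike.star_def, Matrix.mulVec, dyad_ketMinus,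
    Matrix.kroneckerMap_apply, Matrix.one_apply, Matrix.of_apply, Matrix.cons_val',
    Matrix.cons_val_fin_one, ite_mul, one_mul, zero_mul, Fintype.sum_prod_type,
    Finset.sum_ite_irrel, Fin.sum_univ_two, Fin.isValue, Matrix.cons_val_zero, Matrix.cons_val_one,
    Finset.sum_const_zero, Finset.sum_ite_eq, Finset.mem_univ, ↓reduceIte, neg_mul, star_sub]
  ring

theorem phaseErrorForm_eq {f : ℝ → ℝ} {μ β : ℝ} (hβμ : β ^ 2 < μ) (hf_nonneg : ∀ x, 0 ≤ f x)
    (x : ℝ) (φ ψ : SpaceAC) :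
    phaseErrorForm f μ β x φ ψ = 2⁻¹ * f x *
      (star ((φ 0 : ℝ → ℂ) x - Real.cos (theta μ β x) * (φ 0 : ℝ → ℂ) (-x)
          - Real.sin (theta μ β x) * (φ 1 : ℝ → ℂ) (-x))
        * ((ψ 0 : ℝ → ℂ) x - Real.cos (theta μ β x) * (ψ 0 : ℝ → ℂ) (-x)
          - Real.sin (theta μ β x) * (ψ 1 : ℝ → ℂ) (-x))
      + star ((φ 1 : ℝ → ℂ) x + Real.sin (theta μ β x) * (φ 0 : ℝ → ℂ) (-x)
          - Real.cos (theta μ β x) * (φ 1 : ℝ → ℂ) (-x))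
        * ((ψ 1 : ℝ → ℂ) x + Real.sin (theta μ β x) * (ψ 0 : ℝ → ℂ) (-x)
          - Real.cos (theta μ β x) * (ψ 1 : ℝ → ℂ) (-x))) := by
  have hsq : ((Real.sqrt (f x) : ℝ) : ℂ) * (Real.sqrt (f x) : ℝ) = f x := by
    rw [← Complex.ofReal_mul, Real.mul_self_sqrt (hf_nonneg x)]
  rw [phaseErrorForm, ← Matrix.mulVec_mulVec, ← Matrix.mulVec_mulVec, Matrix.dotProduct_mulVec,
    Matrix.vecMul_conjTranspose, star_star, one_kronecker_dyad_ketMinus_form,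
    twistV_mulVec hβμ, twistV_mulVec hβμ, ← hsq]
  simp only [krausHom, ket0, Fin.isValue, Matrix.cons_val_zero, one_mul, ket1, zero_mul, add_zero,
    Matrix.cons_val_one, Matrix.cons_val_fin_one, zero_add, neg_mul, Matrix.of_apply,
    Matrix.cons_val', star_sub, star_mul', RCLike.star_def, Complex.conj_ofReal, star_add, star_neg]
  ring

/-! ### The two sectors -/

section Sectors

/-- The component of a joint state in the sector `s = ±1`, the eigenspace of `X_A ⊗ parity` for the
eigenvalue `-s`. The vector `|0⟩ ⊗ χ - s |1⟩ ⊗ parity χ` of that eigenspace is identified with `χ`,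
which makes this map `√2` times a coisometry. -/
def sectorMap (s : ℝ) : SpaceAC →L[ℂ] ModeC :=
  PiLp.proj (𝕜 := ℂ) 2 (fun _ : Fin 2 => ModeC) 0 -
    (s : ℂ) • (parity ∘L PiLp.proj (𝕜 := ℂ) 2 (fun _ : Fin 2 => ModeC) 1)

theorem sectorMap_apply (s : ℝ) (ψ : SpaceAC) :
    sectorMap s ψ = ψ 0 - (s : ℂ) • parity (ψ 1) := rfl

theorem coeFn_sectorMap (s : ℝ) (ψ : SpaceAC) :
    sectorMap s ψ =ᵐ[volume] fun x => (ψ 0 : ℝ → ℂ) x - s * (ψ 1 : ℝ → ℂ) (-x) := by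
  rw [sectorMap_apply]
  filter_upwards [Lp.coeFn_sub (ψ 0) ((s : ℂ) • parity (ψ 1)),
    Lp.coeFn_smul (s : ℂ) (parity (ψ 1)), coeFn_parity (ψ 1)] with x hsub hsmul hparity
  rw [hsub, Pi.sub_apply, hsmul, Pi.smul_apply, hparity, smul_eq_mul]

theorem coeFn_projOdd_sectorMap (s : ℝ) (ψ : SpaceAC) :
    projOdd (sectorMap s ψ) =ᵐ[volume] fun x => (2⁻¹ : ℂ) *
      ((ψ 0 : ℝ → ℂ) x - s * (ψ 1 : ℝ → ℂ) (-x) - ((ψ 0 : ℝ → ℂ) (-x) - s * (ψ 1 : ℝ → ℂ) x)) := by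
  filter_upwards [coeFn_projOdd (sectorMap s ψ), coeFn_sectorMap s ψ,
    ae_neg (coeFn_sectorMap s ψ)] with x h hpos hneg
  rw [h, hpos, hneg, neg_neg]

theorem coeFn_projEven_sectorMap (s : ℝ) (ψ : SpaceAC) :
    projEven (sectorMap s ψ) =ᵐ[volume] fun x => (2⁻¹ : ℂ) *
      ((ψ 0 : ℝ → ℂ) x - s * (ψ 1 : ℝ → ℂ) (-x) + ((ψ 0 : ℝ → ℂ) (-x) - s * (ψ 1 : ℝ → ℂ) x)) := by
  filter_upwards [coeFn_projEven (sectorMap s ψ), coeFn_sectorMap s ψ,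
    ae_neg (coeFn_sectorMap s ψ)] with x h hpos hneg
  rw [h, hpos, hneg, neg_neg]

/-- The matrix elements of the integrand of the phase error operator within the sector `s`. -/
def sectorForm (f : ℝ → ℝ) (μ β s x : ℝ) (φ ψ : ModeC) : ℂ :=
  formOO f μ β x φ ψ + s * (formOE f μ β x φ ψ + star (formOE f μ β x ψ φ)) + formEE f μ β x φ ψ

/-- The block of the phase error operator in the sector `s`. -/
def sectorOp (f : ℝ → ℝ) (μ β s : ℝ) : ModeC →L[ℂ] ModeC :=
  opOO f μ β + (s : ℂ) • (opOE f μ β + opEO f μ β) + opEE f μ β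

section

variable {f : ℝ → ℝ} (hf : MemLp f ⊤ (volume : Measure ℝ)) (μ β s : ℝ)
include hf

theorem isOpIntegral_sectorForm : IsOpIntegral (sectorForm f μ β s) (sectorOp f μ β s) :=
  have hOE := isOpIntegral_opOE hf μ β
  ((isOpIntegral_opOO hf μ β).add ((hOE.add hOE.adjoint).const_mul s)).add
    (isOpIntegral_opEE hf μ β)

theorem isSelfAdjoint_sectorOp : IsSelfAdjoint (sectorOp f μ β s) :=
  ((isSelfAdjoint_opOO hf μ β).add
    (IsSelfAdjoint.smul (Complex.conj_ofReal s) (IsSelfAdjoint.add_star_self _))).add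
    (isSelfAdjoint_opEE hf μ β)

end

theorem phaseErrorForm_ae_eq_sectorForm {f : ℝ → ℝ} {μ β : ℝ} (hβμ : β ^ 2 < μ)
    (hf : ∀ x, 0 ≤ f x) (φ ψ : SpaceAC) :
    ∀ᵐ x, phaseErrorForm f μ β x φ ψ = (2⁻¹ : ℂ) *
      (sectorForm f μ β 1 x (sectorMap 1 φ) (sectorMap 1 ψ) +
        sectorForm f μ β (-1) x (sectorMap (-1) φ) (sectorMap (-1) ψ)) := by
  filter_upwards [coeFn_projOdd_sectorMap 1 φ, coeFn_projOdd_sectorMap (-1) φ,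
    coeFn_projEven_sectorMap 1 φ, coeFn_projEven_sectorMap (-1) φ, coeFn_projOdd_sectorMap 1 ψ,
    coeFn_projOdd_sectorMap (-1) ψ, coeFn_projEven_sectorMap 1 ψ,
    coeFn_projEven_sectorMap (-1) ψ] with x hoφ hoφ' heφ heφ' hoψ hoψ' heψ heψ'
  have hcs : (Real.cos (theta μ β x) : ℂ) ^ 2 + (Real.sin (theta μ β x) : ℂ) ^ 2 = 1 := by
    exact_mod_cast Real.cos_sq_add_sin_sq (theta μ β x)
  rw [phaseErrorForm_eq hβμ hf]
  simp only [sectorForm, formOO, formOE, formEE, sandwichForm, hoφ, hoφ', heφ, heφ', hoψ, hoψ',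
    heψ, heψ', RCLike.star_def, map_mul, map_add, map_sub, map_inv₀, map_ofNat,
    Complex.conj_ofReal, Complex.conj_conj]
  push_cast [-Complex.ofReal_cos, -Complex.ofReal_sin]
  generalize (Real.cos (theta μ β x) : ℂ) = c at *
  generalize (Real.sin (theta μ β x) : ℂ) = s at *
  linear_combination ((2⁻¹ : ℂ) * f x *
    ((starRingEnd ℂ) ((φ 0 : ℝ → ℂ) (-x)) * (ψ 0 : ℝ → ℂ) (-x) +
     (starRingEnd ℂ) ((φ 1 : ℝ → ℂ) (-x)) * (ψ 1 : ℝ → ℂ) (-x))) * hcs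

/-- The operator `Σ_s S_s† (T s) S_s / 2` on `AC`, where `s` runs over `±1` and `S_s` is
`sectorMap s`: it acts as `T s` in the sector `s`. -/
def sectorSum : (ℝ → ModeC →L[ℂ] ModeC) →ₗ[ℂ] SpaceAC →L[ℂ] SpaceAC where
  toFun T := (2⁻¹ : ℂ) • (ContinuousLinearMap.adjoint (sectorMap 1) ∘L T 1 ∘L sectorMap 1 +
    ContinuousLinearMap.adjoint (sectorMap (-1)) ∘L T (-1) ∘L sectorMap (-1))
  map_add' T T' := by
    simp only [Pi.add_apply, ContinuousLinearMap.add_comp, ContinuousLinearMap.comp_add, smul_add]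
    abel
  map_smul' c T := by
    simp only [Pi.smul_apply, ContinuousLinearMap.smul_comp, ContinuousLinearMap.comp_smul,
      ← smul_add, smul_comm c, RingHom.id_apply]

theorem inner_sectorSum (T : ℝ → ModeC →L[ℂ] ModeC) (φ ψ : SpaceAC) :
    inner ℂ φ (sectorSum T ψ) = 2⁻¹ * (inner ℂ (sectorMap 1 φ) (T 1 (sectorMap 1 ψ)) +
      inner ℂ (sectorMap (-1) φ) (T (-1) (sectorMap (-1) ψ))) := by
  simp only [sectorSum, LinearMap.coe_mk, AddHom.coe_mk, smul_apply, add_apply,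
    ContinuousLinearMap.comp_apply, inner_smul_right, inner_add_right,
    ContinuousLinearMap.adjoint_inner_right]

open scoped ComplexOrder in
theorem isPositive_sectorSum {T : ℝ → ModeC →L[ℂ] ModeC} (h₁ : (T 1).IsPositive)
    (h₂ : (T (-1)).IsPositive) : (sectorSum T).IsPositive :=
  ((h₁.adjoint_conj _).add (h₂.adjoint_conj _)).smul_of_nonneg (inv_nonneg.2 zero_le_two)

theorem isOpIntegral_phaseErrorForm {f : ℝ → ℝ} (hf : MemLp f ⊤ (volume : Measure ℝ))
    (hf_nonneg : ∀ x, 0 ≤ f x) {μ β : ℝ} (hβμ : β ^ 2 < μ) :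
    IsOpIntegral (phaseErrorForm f μ β) (sectorSum (sectorOp f μ β)) :=
  ((((isOpIntegral_sectorForm hf μ β 1).adjoint_comp_comp (sectorMap 1)).add
    ((isOpIntegral_sectorForm hf μ β (-1)).adjoint_comp_comp (sectorMap (-1)))).const_mul
    2⁻¹).congr_ae fun φ ψ => (phaseErrorForm_ae_eq_sectorForm hβμ hf_nonneg φ ψ).mono
      fun _ hx => hx.symm

theorem sectorSum_one : sectorSum 1 = ContinuousLinearMap.id ℂ SpaceAC := by
  refine ContinuousLinearMap.ext fun ψ => ext_inner_left ℂ fun φ => ?_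
  have hparity : inner ℂ (parity (φ 1)) (parity (ψ 1)) = inner ℂ (φ 1) (ψ 1) := by
    rw [inner_parity_left, parity_involutive]
  rw [inner_sectorSum]
  simp only [sectorMap_apply, Pi.one_apply, one_apply_eq_self,
    ContinuousLinearMap.id_apply, PiLp.inner_apply, Fin.sum_univ_two, inner_sub_left,
    inner_sub_right, inner_smul_left, inner_smul_right, Complex.conj_ofReal, hparity]
  push_cast
  ring

theorem inner_tensorAC (P : Matrix (Fin 2) (Fin 2) ℂ) (T : ModeC →L[ℂ] ModeC) (φ ψ : SpaceAC) :
    inner ℂ φ (tensorAC P T ψ) = ∑ i, ∑ j, P i j * inner ℂ (φ i) (T (ψ j)) := by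
  rw [PiLp.inner_apply]
  refine Finset.sum_congr rfl fun i _ => ?_
  simp_rw [← inner_smul_right, ← inner_sum]
  simp [tensorAC]

theorem projFid_eq_sectorSum (β : ℝ) : projFid β =
    sectorSum fun _ => InnerProductSpace.rankOne ℂ (coherentState β) (coherentState β) := by
  refine ContinuousLinearMap.ext fun ψ => ext_inner_left ℂ fun φ => ?_
  have hright : inner ℂ (coherentState β) (parity (ψ 1)) = inner ℂ (coherentState (-β)) (ψ 1) := by
    rw [← inner_parity_left, parity_coherentState]
  have hleft : inner ℂ (parity (φ 1)) (coherentState β) = inner ℂ (φ 1) (coherentState (-β)) := by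
    rw [inner_parity_left, parity_coherentState]
  simp only [projFid, add_apply, inner_add_right, inner_tensorAC, dyad_ket0, dyad_ket1,
    inner_sectorSum, sectorMap_apply, InnerProductSpace.rankOne_apply, inner_smul_right,
    inner_sub_left, inner_sub_right, inner_smul_left, Complex.conj_ofReal, hleft, hright,
    Fin.sum_univ_two, Matrix.of_apply, Matrix.cons_val]
  push_cast
  ring

theorem projTrash_eq_sectorSum : projTrash = sectorSum fun s =>
    (((1 - s) / 2 : ℝ) : ℂ) • projOdd + (((1 + s) / 2 : ℝ) : ℂ) • projEven := by
  refine ContinuousLinearMap.ext fun ψ => ext_inner_left ℂ fun φ => ?_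
  simp only [projTrash, add_apply, inner_add_right, inner_tensorAC, dyad_ketMinus,
    inner_sectorSum, sectorMap_apply, smul_apply, inner_smul_right, projOdd_apply, projEven_apply,
    map_sub, map_smul, parity_involutive _, inner_sub_left, inner_sub_right, inner_smul_left,
    Complex.conj_ofReal, inner_parity_left,
    Fin.sum_univ_two, Matrix.of_apply, Matrix.cons_val, ContinuousLinearMap.id_apply]
  push_cast
  ring

/-- The block of `M[κ,γ]` in the sector `s`, where the trash projection takes the weight `γo` on odd
and `γe` on even states. -/
def sectorTotal (f : ℝ → ℝ) (μ β κ γo γe s : ℝ) : ModeC →L[ℂ] ModeC :=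
  sectorOp f μ β s +
    (κ : ℂ) • InnerProductSpace.rankOne ℂ (coherentState β) (coherentState β) -
    ((γo : ℂ) • projOdd + (γe : ℂ) • projEven)

theorem isSelfAdjoint_sectorTotal {f : ℝ → ℝ} (hf : MemLp f ⊤ (volume : Measure ℝ))
    (μ β κ γo γe s : ℝ) : IsSelfAdjoint (sectorTotal f μ β κ γo γe s) := by
  have hreal (r : ℝ) : IsSelfAdjoint (r : ℂ) := Complex.conj_ofReal r
  exact ((isSelfAdjoint_sectorOp hf μ β s).add ((hreal κ).smul
    (InnerProductSpace.isSymmetric_rankOne_self _).isSelfAdjoint)).sub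
    (((hreal γo).smul isStarProjection_projOdd.isSelfAdjoint).add
      ((hreal γe).smul isStarProjection_projEven.isSelfAdjoint))

theorem opM_eq_sectorSum {f : ℝ → ℝ} (hf : MemLp f ⊤ (volume : Measure ℝ))
    (hf_nonneg : ∀ x, 0 ≤ f x) {μ β : ℝ} (hβμ : β ^ 2 < μ) (κ γ : ℝ) :
    opM f μ β κ γ =
      sectorSum fun s => sectorTotal f μ β κ (γ * ((1 - s) / 2)) (γ * ((1 + s) / 2)) s := by
  rw [opM, phaseErrorOp, (isOpIntegral_phaseErrorForm hf hf_nonneg hβμ).opIntegral_eq,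
    projFid_eq_sectorSum, projTrash_eq_sectorSum, ← map_smul, ← map_smul, ← map_add, ← map_sub]
  refine congrArg sectorSum (funext fun s => ?_)
  simp only [sectorTotal, Pi.sub_apply, Pi.add_apply, Pi.smul_apply, smul_add, smul_smul,
    Complex.ofReal_mul]

end Sectors

/-! ### The a priori bound on the phase error operator -/

section PhaseErrorBound

theorem two_mul_integral_mul_le_of_even {f g h : ℝ → ℝ} (hf : ∀ x, f x + f (-x) ≤ 1)
    (hg : ∀ x, 0 ≤ g x) (heven : ∀ᵐ x, g (-x) = g x) (hgh : ∀ x, g x ≤ h x)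
    (hfg : Integrable fun x => f x * g x) (hh : Integrable h) :
    2 * ∫ x, f x * g x ≤ ∫ x, h x :=
  calc 2 * ∫ x, f x * g x = ∫ x, (f x * g x + f (-x) * g (-x)) := by
        rw [integral_add hfg hfg.comp_neg, integral_neg_eq_self (fun x => f x * g x), two_mul]
    _ ≤ ∫ x, h x := by
        refine integral_mono_ae (hfg.add hfg.comp_neg) hh ?_
        filter_upwards [heven] with x hx
        calc f x * g x + f (-x) * g (-x) = (f x + f (-x)) * g x := by rw [hx, add_mul]
          _ ≤ g x := mul_le_of_le_one_left (hg x) (hf x)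
          _ ≤ h x := hgh x

theorem integrable_norm_sq_coeFn (ψ : ModeC) : Integrable fun x => ‖(ψ : ℝ → ℂ) x‖ ^ 2 :=
  (memLp_two_iff_integrable_sq_norm (Lp.aestronglyMeasurable ψ)).1 (Lp.memLp ψ)

theorem integral_norm_sq_coeFn (ψ : ModeC) : ∫ x, ‖(ψ : ℝ → ℂ) x‖ ^ 2 = ‖ψ‖ ^ 2 := by
  rw [← inner_self_eq_norm_sq (𝕜 := ℂ), L2.inner_def, ← integral_re (L2.integrable_inner ψ ψ)]
  exact integral_congr_ae (.of_forall fun x => (inner_self_eq_norm_sq (𝕜 := ℂ) _).symm)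

theorem norm_sq_projOdd_add_norm_sq_projEven (ψ : ModeC) :
    ‖projOdd ψ‖ ^ 2 + ‖projEven ψ‖ ^ 2 = ‖ψ‖ ^ 2 := by
  rw [norm_sq_apply_of_isStarProjection isStarProjection_projOdd,
    norm_sq_apply_of_isStarProjection isStarProjection_projEven, ← map_add, ← inner_add_right,
    projEven_eq_one_sub, sub_apply, one_apply_eq_self, add_sub_cancel, inner_self_eq_norm_sq]

theorem theta_neg (μ β x : ℝ) : theta μ β (-x) = -theta μ β x := by
  rw [theta, theta, mul_neg, Real.sinh_neg, mul_neg, Real.arctan_neg]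

theorem norm_ofReal_mul_add_sq_le (a b : ℝ) (z w : ℂ) :
    ‖a * z + b * w‖ ^ 2 ≤ (a ^ 2 + b ^ 2) * (‖z‖ ^ 2 + ‖w‖ ^ 2) :=
  calc ‖a * z + b * w‖ ^ 2 ≤ (|a| * ‖z‖ + |b| * ‖w‖) ^ 2 := by
        gcongr
        simpa only [norm_mul, Complex.norm_real, Real.norm_eq_abs] using norm_add_le (a * z) (b * w)
    _ ≤ (|a| ^ 2 + |b| ^ 2) * (‖z‖ ^ 2 + ‖w‖ ^ 2) := by
        nlinarith [sq_nonneg (|a| * ‖w‖ - |b| * ‖z‖)]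
    _ = (a ^ 2 + b ^ 2) * (‖z‖ ^ 2 + ‖w‖ ^ 2) := by rw [sq_abs, sq_abs]

theorem sectorForm_self (f : ℝ → ℝ) (μ β : ℝ) {s : ℝ} (hs : s ^ 2 = 1) (x : ℝ) (χ : ModeC) :
    sectorForm f μ β s x χ χ = ((2 * (f x *
      ‖(Real.cos (theta μ β x / 2) : ℂ) * (projOdd χ : ℝ → ℂ) x +
        (s * Real.sin (theta μ β x / 2) : ℝ) * (projEven χ : ℝ → ℂ) x‖ ^ 2) : ℝ) : ℂ) := by
  have hcos : Real.cos (theta μ β x) = 2 * Real.cos (theta μ β x / 2) ^ 2 - 1 := by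
    rw [← Real.cos_two_mul, mul_div_cancel₀ _ two_ne_zero]
  have hsin : Real.sin (theta μ β x) =
      2 * Real.sin (theta μ β x / 2) * Real.cos (theta μ β x / 2) := by
    rw [← Real.sin_two_mul, mul_div_cancel₀ _ two_ne_zero]
  have hcs : (Real.cos (theta μ β x / 2) : ℂ) ^ 2 + (Real.sin (theta μ β x / 2) : ℂ) ^ 2 = 1 := by
    exact_mod_cast Real.cos_sq_add_sin_sq (theta μ β x / 2)
  have hs' : (s : ℂ) ^ 2 = 1 := mod_cast hs
  rw [Complex.ofReal_mul, Complex.ofReal_mul, Complex.ofReal_pow, ← Complex.conj_mul']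
  simp only [sectorForm, formOO, formOE, formEE, sandwichForm, hcos, hsin, RCLike.star_def,
    map_mul, map_add, Complex.conj_ofReal, Complex.conj_conj]
  push_cast [-Complex.ofReal_cos, -Complex.ofReal_sin]
  generalize (Real.cos (theta μ β x / 2) : ℂ) = c at *
  generalize (Real.sin (theta μ β x / 2) : ℂ) = t at *
  generalize (projEven χ : ℝ → ℂ) x = e
  linear_combination (-2 * f x * ((starRingEnd ℂ) e * e)) * hcs -
    (2 * f x * t ^ 2 * ((starRingEnd ℂ) e * e)) * hs'

theorem re_inner_sectorOp_le {f : ℝ → ℝ} (hf : MemLp f ⊤ (volume : Measure ℝ))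
    (hf_le : ∀ x, f x + f (-x) ≤ 1) (μ β : ℝ) {s : ℝ} (hs : s ^ 2 = 1) (χ : ModeC) :
    (inner ℂ χ (sectorOp f μ β s χ)).re ≤ ‖χ‖ ^ 2 := by
  set g : ℝ → ℝ := fun x => ‖(Real.cos (theta μ β x / 2) : ℂ) * (projOdd χ : ℝ → ℂ) x +
    (s * Real.sin (theta μ β x / 2) : ℝ) * (projEven χ : ℝ → ℂ) x‖ ^ 2 with hg
  have hform (x : ℝ) : sectorForm f μ β s x χ χ = ((2 * (f x * g x) : ℝ) : ℂ) :=
    sectorForm_self f μ β hs x χ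
  obtain ⟨hint, hinner⟩ := isOpIntegral_sectorForm hf μ β s χ χ
  simp only [hform, integral_complex_ofReal, integral_const_mul] at hint hinner
  have hfg : Integrable fun x => f x * g x := by
    simpa using hint.re.const_mul 2⁻¹
  have heven : ∀ᵐ x, g (-x) = g x := by
    filter_upwards [coeFn_projOdd χ, coeFn_projEven χ, ae_neg (coeFn_projOdd χ),
      ae_neg (coeFn_projEven χ)] with x ho he ho' he'
    simp only [hg]
    rw [ho, he, ho', he', theta_neg, neg_div, Real.cos_neg, Real.sin_neg, neg_neg, ← norm_neg]
    congr 2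
    push_cast
    ring
  have hle (x : ℝ) : g x ≤ ‖(projOdd χ : ℝ → ℂ) x‖ ^ 2 + ‖(projEven χ : ℝ → ℂ) x‖ ^ 2 := by
    refine (norm_ofReal_mul_add_sq_le _ _ _ _).trans_eq ?_
    rw [mul_pow, hs, one_mul, Real.cos_sq_add_sin_sq, one_mul]
  have ho := integrable_norm_sq_coeFn (projOdd χ)
  have he := integrable_norm_sq_coeFn (projEven χ)
  calc (inner ℂ χ (sectorOp f μ β s χ)).re = 2 * ∫ x, f x * g x := by
        rw [hinner, Complex.ofReal_re]
    _ ≤ ∫ x, (‖(projOdd χ : ℝ → ℂ) x‖ ^ 2 + ‖(projEven χ : ℝ → ℂ) x‖ ^ 2) :=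
        two_mul_integral_mul_le_of_even hf_le (fun x => sq_nonneg _) heven hle hfg (ho.add he)
    _ = ‖χ‖ ^ 2 := by
        rw [integral_add ho he, integral_norm_sq_coeFn, integral_norm_sq_coeFn,
          norm_sq_projOdd_add_norm_sq_projEven]

end PhaseErrorBound

/-! ### The largest eigenvalue of a symmetric matrix -/

section LargestEigenvalue

theorem re_dotProduct_map_ofReal_mulVec {𝕜 n : Type*} [RCLike 𝕜] [Fintype n] (M : Matrix n n ℝ)
    (x : n → 𝕜) : RCLike.re (star x ⬝ᵥ M.map (fun r => (r : 𝕜)) *ᵥ x) =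
      (fun i => RCLike.re (x i)) ⬝ᵥ M *ᵥ (fun i => RCLike.re (x i)) +
        (fun i => RCLike.im (x i)) ⬝ᵥ M *ᵥ fun i => RCLike.im (x i) := by
  simp only [dotProduct, Matrix.mulVec, Finset.mul_sum, map_sum, ← Finset.sum_add_distrib]
  refine Finset.sum_congr rfl fun i _ => Finset.sum_congr rfl fun j _ => ?_
  simp

open scoped MatrixOrder

variable {n : Type*} [Fintype n] [DecidableEq n] [Nonempty n]

theorem sSup_spectrum_le_iff {M : Matrix n n ℝ} (hM : M.IsHermitian) {c : ℝ} :
    sSup (spectrum ℝ M) ≤ c ↔ M ≤ algebraMap ℝ (Matrix n n ℝ) c := by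
  have hne : (spectrum ℝ M).Nonempty := by
    rw [hM.spectrum_real_eq_range_eigenvalues]
    exact Set.range_nonempty _
  rw [csSup_le_iff Matrix.finite_real_spectrum.bddAbove hne,
    le_algebraMap_iff_spectrum_le (ha := hM.isSelfAdjoint)]

theorem convexOn_sSup_spectrum :
    ConvexOn ℝ {M : Matrix n n ℝ | M.IsHermitian} fun M => sSup (spectrum ℝ M) := by
  have hconv : Convex ℝ {M : Matrix n n ℝ | M.IsHermitian} :=
    (selfAdjoint.submodule ℝ (Matrix n n ℝ)).convex
  refine ⟨hconv, fun M hM N hN a b ha hb hab => ?_⟩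
  rw [sSup_spectrum_le_iff (hconv hM hN ha hb hab), map_add, smul_eq_mul, smul_eq_mul, map_mul,
    map_mul, ← Algebra.smul_def, ← Algebra.smul_def]
  exact add_le_add (smul_le_smul_of_nonneg_left ((sSup_spectrum_le_iff hM).1 le_rfl) ha)
    (smul_le_smul_of_nonneg_left ((sSup_spectrum_le_iff hN).1 le_rfl) hb)

theorem dotProduct_mulVec_le {M : Matrix n n ℝ} (hM : M.IsHermitian) (x : n → ℝ) :
    x ⬝ᵥ M *ᵥ x ≤ sSup (spectrum ℝ M) * (x ⬝ᵥ x) := by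
  have h := (Matrix.le_iff.1 ((sSup_spectrum_le_iff hM).1 le_rfl)).dotProduct_mulVec_nonneg x
  rwa [Matrix.sub_mulVec, dotProduct_sub, star_trivial, Algebra.algebraMap_eq_smul_one,
    Matrix.smul_mulVec, Matrix.one_mulVec, dotProduct_smul, smul_eq_mul, sub_nonneg] at h

theorem re_dotProduct_map_ofReal_mulVec_le {𝕜 : Type*} [RCLike 𝕜] {M : Matrix n n ℝ}
    (hM : M.IsHermitian) (x : n → 𝕜) :
    RCLike.re (star x ⬝ᵥ M.map (fun r => (r : 𝕜)) *ᵥ x) ≤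
      sSup (spectrum ℝ M) * RCLike.re (star x ⬝ᵥ x) := by
  have hnorm : RCLike.re (star x ⬝ᵥ x) = (fun i => RCLike.re (x i)) ⬝ᵥ (fun i => RCLike.re (x i)) +
      (fun i => RCLike.im (x i)) ⬝ᵥ fun i => RCLike.im (x i) := by
    simp [dotProduct, ← Finset.sum_add_distrib]
  rw [re_dotProduct_map_ofReal_mulVec, hnorm, mul_add]
  exact add_le_add (dotProduct_mulVec_le hM _) (dotProduct_mulVec_le hM _)

theorem apply_self_le_sSup_spectrum {M : Matrix n n ℝ} (hM : M.IsHermitian) (i : n) :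
    M i i ≤ sSup (spectrum ℝ M) := by
  simpa using dotProduct_mulVec_le hM (Pi.single i 1)

end LargestEigenvalue

/-! ### Reducing an operator bound to a finite matrix -/

section Compression

variable {𝕜 H ι : Type*} [RCLike 𝕜] [NormedAddCommGroup H] [InnerProductSpace 𝕜 H]

/-- A family of pairwise orthogonal vectors each of which is either a unit vector or zero, as
produced by the Gram–Schmidt process applied to a possibly dependent family. -/
structure IsOrthonormalOrZero (𝕜 : Type*) {H ι : Type*} [RCLike 𝕜] [NormedAddCommGroup H]
    [InnerProductSpace 𝕜 H] (b : ι → H) : Prop where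
  norm_eq_one : ∀ i, b i ≠ 0 → ‖b i‖ = 1
  inner_eq_zero : Pairwise fun i j => inner 𝕜 (b i) (b j) = 0

namespace IsOrthonormalOrZero

variable {b : ι → H} {ι' : Type*}

theorem comp (hb : IsOrthonormalOrZero 𝕜 b) {e : ι' → ι} (he : Function.Injective e) :
    IsOrthonormalOrZero 𝕜 (b ∘ e) where
  norm_eq_one i := hb.norm_eq_one (e i)
  inner_eq_zero := hb.inner_eq_zero.comp_of_injective he

theorem sumElim {b' : ι' → H} (hb : IsOrthonormalOrZero 𝕜 b)
    (hb' : IsOrthonormalOrZero 𝕜 b') (h : ∀ i j, inner 𝕜 (b i) (b' j) = 0) :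
    IsOrthonormalOrZero 𝕜 (Sum.elim b b') where
  norm_eq_one := Sum.rec hb.norm_eq_one hb'.norm_eq_one
  inner_eq_zero
    | .inl _, .inl _, hij => hb.inner_eq_zero fun h => hij (congrArg _ h)
    | .inl i, .inr j, _ => h i j
    | .inr i, .inl j, _ => inner_eq_zero_symm.1 (h j i)
    | .inr _, .inr _, hij => hb'.inner_eq_zero fun h => hij (congrArg _ h)

end IsOrthonormalOrZero

theorem re_inner_add_map_add {T : H →ₗ[𝕜] H} (hT : T.IsSymmetric) (φ ψ : H) :
    RCLike.re (inner 𝕜 (φ + ψ) (T (φ + ψ))) = RCLike.re (inner 𝕜 φ (T φ))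
      + 2 * RCLike.re (inner 𝕜 ψ (T φ)) + RCLike.re (inner 𝕜 ψ (T ψ)) := by
  have hcross : RCLike.re (inner 𝕜 φ (T ψ)) = RCLike.re (inner 𝕜 ψ (T φ)) := by
    rw [← hT φ ψ, inner_re_symm]
  simp only [map_add, inner_add_left, inner_add_right, hcross]
  ring

variable [Fintype ι]

theorem re_dotProduct_add_mulVec_add {M : Matrix ι ι 𝕜} (hM : M.IsHermitian) (y z : ι → 𝕜) :
    RCLike.re (star (y + z) ⬝ᵥ M *ᵥ (y + z)) = RCLike.re (star y ⬝ᵥ M *ᵥ y)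
      + 2 * RCLike.re (star z ⬝ᵥ M *ᵥ y) + RCLike.re (star z ⬝ᵥ M *ᵥ z) := by
  have hcross : RCLike.re (star y ⬝ᵥ M *ᵥ z) = RCLike.re (star z ⬝ᵥ M *ᵥ y) := by
    rw [← RCLike.conj_re, starRingEnd_apply, ← Matrix.star_dotProduct_star, star_star,
      Matrix.star_mulVec, hM.eq, ← Matrix.dotProduct_mulVec, dotProduct_comm]
  simp only [star_add, Matrix.mulVec_add, add_dotProduct, dotProduct_add, map_add, hcross]
  ring

variable {b : ι → H}

theorem map_sum_smul_eq_sum_mulVec_smul {T : H →ₗ[𝕜] H} {M : Matrix ι ι 𝕜} {y : ι → 𝕜}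
    {t : Finset ι} (hTb : ∀ j, y j ≠ 0 → T (b j) = ∑ i ∈ t, M i j • b i) :
    T (∑ j, y j • b j) = ∑ i ∈ t, (M *ᵥ y) i • b i := by
  simp only [map_sum, map_smul, Matrix.mulVec, dotProduct, Finset.sum_smul]
  rw [Finset.sum_comm]
  refine Finset.sum_congr rfl fun j _ => ?_
  by_cases hj : y j = 0
  · simp [hj]
  · rw [hTb j hj, Finset.smul_sum]
    exact Finset.sum_congr rfl fun i _ => by rw [smul_smul, mul_comm]

namespace IsOrthonormalOrZero

variable (hb : IsOrthonormalOrZero 𝕜 b)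

include hb

theorem inner_sum_smul {i : ι} (x : ι → 𝕜) (hi : b i ≠ 0) :
    inner 𝕜 (b i) (∑ j, x j • b j) = x i := by
  rw [inner_sum, Finset.sum_eq_single i]
  · rw [inner_smul_right, inner_self_eq_norm_sq_to_K, hb.norm_eq_one i hi]
    simp
  · intro j _ hj
    rw [inner_smul_right, hb.inner_eq_zero hj.symm, mul_zero]
  · simp

theorem inner_sum_smul_sum_smul {y : ι → 𝕜} (hy : ∀ i, b i = 0 → y i = 0) (z : ι → 𝕜) :
    inner 𝕜 (∑ i, y i • b i) (∑ i, z i • b i) = star y ⬝ᵥ z := by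
  rw [sum_inner]
  refine Finset.sum_congr rfl fun i _ => ?_
  by_cases hi : b i = 0
  · simp [hi, hy i hi]
  · rw [inner_smul_left, hb.inner_sum_smul z hi, Pi.star_apply, starRingEnd_apply]

theorem inner_sub_sum_inner_smul (χ : H) (i : ι) :
    inner 𝕜 (b i) (χ - ∑ j, inner 𝕜 (b j) χ • b j) = 0 := by
  by_cases hi : b i = 0
  · simp [hi]
  · rw [inner_sub_right, hb.inner_sum_smul _ hi, sub_self]

omit hb in
theorem inner_sum_smul_eq_zero {η : H} (hη : ∀ i, inner 𝕜 (b i) η = 0) (w : ι → 𝕜) :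
    inner 𝕜 η (∑ i, w i • b i) = 0 := by
  rw [inner_sum]
  exact Finset.sum_eq_zero fun i _ => by
    rw [inner_smul_right, inner_eq_zero_symm.1 (hη i), mul_zero]

theorem norm_sq_sum_smul_add {x : ι → 𝕜} (hx : ∀ i, b i = 0 → x i = 0) {η : H}
    (hη : ∀ i, inner 𝕜 (b i) η = 0) :
    ‖∑ i, x i • b i + η‖ ^ 2 = RCLike.re (star x ⬝ᵥ x) + ‖η‖ ^ 2 := by
  rw [norm_add_sq (𝕜 := 𝕜), inner_eq_zero_symm.1 (inner_sum_smul_eq_zero hη x), map_zero, mul_zero,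
    add_zero, norm_sq_eq_re_inner (𝕜 := 𝕜), hb.inner_sum_smul_sum_smul hx]

variable [DecidableEq ι]

theorem re_inner_add_map_add_le {T D : H →ₗ[𝕜] H} (hT : T.IsSymmetric) (hD : D.IsSymmetric)
    {M : Matrix ι ι 𝕜} (hM : M.IsHermitian) {s : Finset ι}
    (hTb : ∀ j ∈ s, T (b j) = ∑ i, M i j • b i)
    (hDb : ∀ j ∉ s, D (b j) = ∑ i ∈ sᶜ, M i j • b i)
    (hTD : ∀ ξ, (∀ i ∈ s, inner 𝕜 (b i) ξ = 0) →
      RCLike.re (inner 𝕜 ξ (T ξ)) ≤ RCLike.re (inner 𝕜 ξ (D ξ)))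
    {x : ι → 𝕜} (hx : ∀ i, b i = 0 → x i = 0) {η : H} (hη : ∀ i, inner 𝕜 (b i) η = 0) :
    RCLike.re (inner 𝕜 (∑ i, x i • b i + η) (T (∑ i, x i • b i + η)))
      ≤ RCLike.re (star x ⬝ᵥ M *ᵥ x) + RCLike.re (inner 𝕜 η (D η)) := by
  let y : ι → 𝕜 := fun i => if i ∈ s then x i else 0
  let z : ι → 𝕜 := fun i => if i ∈ s then 0 else x i
  have hxyz : x = y + z := by
    ext i
    by_cases hi : i ∈ s <;> simp [y, z, hi]
  have hy : ∀ i, b i = 0 → y i = 0 := fun i hi => by simp [y, hx i hi]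
  have hz : ∀ i, b i = 0 → z i = 0 := fun i hi => by simp [z, hx i hi]
  have hzy : ∀ i ∈ s, z i = 0 := fun i hi => by simp [z, hi]
  set κ : H := ∑ i, y i • b i
  set ζ : H := ∑ i, z i • b i
  have hTκ : T κ = ∑ i, (M *ᵥ y) i • b i :=
    map_sum_smul_eq_sum_mulVec_smul fun j hj => hTb j (by_contra fun h => hj (if_neg h))
  have hDζ : D ζ = ∑ i, (if i ∈ s then 0 else (M *ᵥ z) i) • b i := by
    rw [map_sum_smul_eq_sum_mulVec_smul fun j hj => hDb j fun h => hj (if_pos h),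
      ← Finset.sum_subset (Finset.subset_univ sᶜ) (by simp_all)]
    exact Finset.sum_congr rfl fun i hi => by rw [if_neg (Finset.mem_compl.1 hi)]
  have hzMz : star z ⬝ᵥ (fun i => if i ∈ s then 0 else (M *ᵥ z) i) = star z ⬝ᵥ M *ᵥ z :=
    Finset.sum_congr rfl fun i _ => by
      by_cases hi : i ∈ s <;> simp [hi, hzy]
  have hξ : ∀ i ∈ s, inner 𝕜 (b i) (ζ + η) = 0 := fun i hi => by
    by_cases hbi : b i = 0
    · simp [hbi]
    · rw [inner_add_right, hb.inner_sum_smul z hbi, hzy i hi, hη, add_zero]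
  have hTξ := hTD (ζ + η) hξ
  rw [re_inner_add_map_add hD, hDζ, hb.inner_sum_smul_sum_smul hz, hzMz,
    inner_sum_smul_eq_zero hη, map_zero, mul_zero, add_zero] at hTξ
  have hsum : ∑ i, x i • b i + η = κ + (ζ + η) := by
    simp only [κ, ζ, ← add_assoc, ← Finset.sum_add_distrib, ← add_smul, hxyz, Pi.add_apply]
  rw [hsum, re_inner_add_map_add hT, hTκ, hb.inner_sum_smul_sum_smul hy, inner_add_left,
    hb.inner_sum_smul_sum_smul hz, inner_sum_smul_eq_zero hη, add_zero, hxyz,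
    re_dotProduct_add_mulVec_add hM]
  linarith

theorem re_inner_map_le {T D : H →ₗ[𝕜] H} (hT : T.IsSymmetric) (hD : D.IsSymmetric)
    {M : Matrix ι ι 𝕜} (hM : M.IsHermitian) {s : Finset ι}
    (hTb : ∀ j ∈ s, T (b j) = ∑ i, M i j • b i)
    (hDb : ∀ j ∉ s, D (b j) = ∑ i ∈ sᶜ, M i j • b i)
    (hTD : ∀ ξ, (∀ i ∈ s, inner 𝕜 (b i) ξ = 0) →
      RCLike.re (inner 𝕜 ξ (T ξ)) ≤ RCLike.re (inner 𝕜 ξ (D ξ)))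
    {c : ℝ} (hMc : ∀ x, RCLike.re (star x ⬝ᵥ M *ᵥ x) ≤ c * RCLike.re (star x ⬝ᵥ x))
    (hDc : ∀ η, RCLike.re (inner 𝕜 η (D η)) ≤ c * ‖η‖ ^ 2) (χ : H) :
    RCLike.re (inner 𝕜 χ (T χ)) ≤ c * ‖χ‖ ^ 2 := by
  set x : ι → 𝕜 := fun i => inner 𝕜 (b i) χ with hxdef
  have hx : ∀ i, b i = 0 → x i = 0 := fun i hi => by simp [hxdef, hi]
  have hη := hb.inner_sub_sum_inner_smul χ
  set η : H := χ - ∑ i, x i • b i with hηdef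
  have hχ : χ = ∑ i, x i • b i + η := by rw [hηdef, add_sub_cancel]
  rw [hχ, hb.norm_sq_sum_smul_add hx hη]
  linarith [hb.re_inner_add_map_add_le hT hD hM hTb hDb hTD hx hη, hMc x, hDc η]

end IsOrthonormalOrZero

end Compression

section GramSchmidt

open InnerProductSpace Finset

variable {𝕜 H ι : Type*} [RCLike 𝕜] [NormedAddCommGroup H] [InnerProductSpace 𝕜 H]

section WellOrdered

variable [LinearOrder ι] [LocallyFiniteOrderBot ι] [WellFoundedLT ι] (f : ι → H)

theorem isOrthonormalOrZero_gramSchmidtNormed :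
    IsOrthonormalOrZero 𝕜 (gramSchmidtNormed 𝕜 f) where
  norm_eq_one _ hi := gramSchmidtNormed_unit_length' hi
  inner_eq_zero i j hij := by
    simp [gramSchmidtNormed, inner_smul_left, inner_smul_right, gramSchmidt_orthogonal 𝕜 f hij]

theorem norm_smul_gramSchmidtNormed (n : ι) :
    (‖gramSchmidt 𝕜 f n‖ : 𝕜) • gramSchmidtNormed 𝕜 f n = gramSchmidt 𝕜 f n := by
  by_cases h : gramSchmidt 𝕜 f n = 0
  · simp [h]
  · exact smul_inv_smul₀ (mod_cast norm_ne_zero_iff.2 h) _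

theorem eq_sum_inner_gramSchmidtNormed (n : ι) :
    f n = ∑ i ∈ Iio n, inner 𝕜 (gramSchmidtNormed 𝕜 f i) (f n) • gramSchmidtNormed 𝕜 f i
      + (‖gramSchmidt 𝕜 f n‖ : 𝕜) • gramSchmidtNormed 𝕜 f n := by
  conv_lhs => rw [gramSchmidt_def'' 𝕜 f n, add_comm]
  rw [norm_smul_gramSchmidtNormed]
  congr 1
  refine Finset.sum_congr rfl fun i _ => ?_
  rw [gramSchmidtNormed, inner_smul_left, smul_smul, map_inv₀, RCLike.conj_ofReal]
  congr 1
  field_simp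

theorem norm_sq_gramSchmidt (n : ι) :
    ‖gramSchmidt 𝕜 f n‖ ^ 2
      = ‖f n‖ ^ 2 - ∑ i ∈ Iio n, ‖inner 𝕜 (gramSchmidtNormed 𝕜 f i) (f n)‖ ^ 2 := by
  set e := gramSchmidtNormed 𝕜 f with he
  have hperp : inner 𝕜 (gramSchmidt 𝕜 f n) (∑ i ∈ Iio n, inner 𝕜 (e i) (f n) • e i) = 0 := by
    rw [inner_sum]
    refine sum_eq_zero fun i hi => ?_
    rw [he, gramSchmidtNormed, inner_smul_right, inner_smul_right,
      gramSchmidt_orthogonal 𝕜 f (mem_Iio.1 hi).ne', mul_zero, mul_zero]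
  have hf : f n = ∑ i ∈ Iio n, inner 𝕜 (e i) (f n) • e i + gramSchmidt 𝕜 f n := by
    rw [← norm_smul_gramSchmidtNormed]
    exact eq_sum_inner_gramSchmidtNormed f n
  calc ‖gramSchmidt 𝕜 f n‖ ^ 2
    _ = RCLike.re (inner 𝕜 (gramSchmidt 𝕜 f n) (f n)) := by
      conv_rhs => rw [hf]
      rw [inner_add_right, hperp, zero_add, norm_sq_eq_re_inner (𝕜 := 𝕜)]
    _ = RCLike.re (inner 𝕜 (f n) (f n))
          - ∑ i ∈ Iio n, RCLike.re (inner 𝕜 (inner 𝕜 (e i) (f n) • e i) (f n)) := by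
      rw [eq_sub_of_add_eq' hf.symm, inner_sub_left, sum_inner, map_sub, map_sum]
    _ = ‖f n‖ ^ 2 - ∑ i ∈ Iio n, ‖inner 𝕜 (e i) (f n)‖ ^ 2 := by
      simp only [← norm_sq_eq_re_inner, inner_smul_left, RCLike.conj_mul, ← RCLike.ofReal_pow,
        RCLike.ofReal_re]

variable {f}

theorem map_gramSchmidtNormed_eq_self {P : H →ₗ[𝕜] H} (hP : ∀ i, P (f i) = f i) (i : ι) :
    P (gramSchmidtNormed 𝕜 f i) = gramSchmidtNormed 𝕜 f i := by
  have hspan : Set.EqOn P LinearMap.id (Submodule.span 𝕜 (Set.range f)) :=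
    LinearMap.eqOn_span (Set.eqOn_range.2 (funext hP))
  refine hspan ?_
  rw [← span_gramSchmidt, ← span_gramSchmidtNormed_range]
  exact Submodule.subset_span ⟨i, rfl⟩

end WellOrdered

theorem gramSchmidt_fin_three {f : Fin 3 → H} (h0 : ‖f 0‖ = 1) {l m n σ s δ : ℝ}
    (hl : inner 𝕜 (f 0) (f 1) = l) (hm : inner 𝕜 (f 0) (f 2) = m) (hn : inner 𝕜 (f 1) (f 2) = n)
    (hσ : σ = √(‖f 1‖ ^ 2 - l ^ 2)) (hs : s = σ⁻¹ * (n - l * m))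
    (hδ : δ = √(‖f 2‖ ^ 2 - m ^ 2 - s ^ 2)) :
    gramSchmidtNormed 𝕜 f 0 = f 0 ∧
      f 1 = (l : 𝕜) • f 0 + (σ : 𝕜) • gramSchmidtNormed 𝕜 f 1 ∧
      f 2 = (m : 𝕜) • f 0 + (s : 𝕜) • gramSchmidtNormed 𝕜 f 1
        + (δ : 𝕜) • gramSchmidtNormed 𝕜 f 2 := by
  have hIio1 : Iio (1 : Fin 3) = {0} := rfl
  have hIio2 : Iio (2 : Fin 3) = {0, 1} := rfl
  have e0 : gramSchmidtNormed 𝕜 f 0 = f 0 := by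
    rw [gramSchmidtNormed, show gramSchmidt 𝕜 f 0 = f 0 from gramSchmidt_bot 𝕜 f, h0]
    simp
  have norm_one : ‖gramSchmidt 𝕜 f 1‖ = σ := by
    rw [hσ, ← Real.sqrt_sq (norm_nonneg _), norm_sq_gramSchmidt, hIio1, sum_singleton, e0, hl,
      RCLike.norm_ofReal, sq_abs]
  have f1 : f 1 = (l : 𝕜) • f 0 + (σ : 𝕜) • gramSchmidtNormed 𝕜 f 1 := by
    have h := eq_sum_inner_gramSchmidtNormed (𝕜 := 𝕜) f 1
    rwa [hIio1, sum_singleton, e0, hl, norm_one] at h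
  have inner_one : inner 𝕜 (gramSchmidtNormed 𝕜 f 1) (f 2) = s := by
    have hgs : gramSchmidt 𝕜 f 1 = f 1 - (l : 𝕜) • f 0 := by
      rw [eq_sub_iff_add_eq', ← norm_smul_gramSchmidtNormed, norm_one, ← f1]
    rw [gramSchmidtNormed, norm_one, hgs, inner_smul_left, inner_sub_left, inner_smul_left, hn, hm,
      hs]
    simp
  have norm_two : ‖gramSchmidt 𝕜 f 2‖ = δ := by
    rw [hδ, ← Real.sqrt_sq (norm_nonneg _), norm_sq_gramSchmidt, hIio2, sum_pair (by decide), e0,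
      hm, inner_one, RCLike.norm_ofReal, RCLike.norm_ofReal, sq_abs, sq_abs, sub_sub]
  refine ⟨e0, f1, ?_⟩
  have h := eq_sum_inner_gramSchmidtNormed (𝕜 := 𝕜) f 2
  rwa [hIio2, sum_pair (by decide), e0, hm, inner_one, norm_two] at h

end GramSchmidt

/-! ### The six-dimensional frame -/

section Frame

/-- The normalised odd component of the coherent state `|β⟩`. -/
def oddUnit (β : ℝ) : ModeC := (((√(coefO β))⁻¹ : ℝ) : ℂ) • projOdd (coherentState β)

/-- The normalised even component of the coherent state `|β⟩`. -/
def evenUnit (β : ℝ) : ModeC := (((√(coefE β))⁻¹ : ℝ) : ℂ) • projEven (coherentState β)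

theorem norm_inv_sqrt_smul {H : Type*} [NormedAddCommGroup H] [NormedSpace ℂ H] {r : ℝ}
    (hr : 0 ≤ r) (v : H) : ‖(((√r)⁻¹ : ℝ) : ℂ) • v‖ ^ 2 = r⁻¹ * ‖v‖ ^ 2 := by
  rw [norm_smul, Complex.norm_real, Real.norm_eq_abs, mul_pow, sq_abs, inv_pow, Real.sq_sqrt hr]

theorem coefO_nonneg (β : ℝ) : 0 ≤ coefO β :=
  norm_sq_projOdd_coherentState β ▸ sq_nonneg _

theorem norm_oddUnit {β : ℝ} (hβ : β ≠ 0) : ‖oddUnit β‖ = 1 := by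
  have hsq : ‖oddUnit β‖ ^ 2 = 1 := by
    rw [oddUnit, norm_inv_sqrt_smul (coefO_nonneg β), norm_sq_projOdd_coherentState,
      inv_mul_cancel₀ (coefO_pos hβ).ne']
  exact (pow_eq_one_iff_of_nonneg (norm_nonneg _) two_ne_zero).1 hsq

theorem norm_evenUnit (β : ℝ) : ‖evenUnit β‖ = 1 := by
  have hsq : ‖evenUnit β‖ ^ 2 = 1 := by
    rw [evenUnit, norm_inv_sqrt_smul (coefE_pos β).le, norm_sq_projEven_coherentState,
      inv_mul_cancel₀ (coefE_pos β).ne']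
  exact (pow_eq_one_iff_of_nonneg (norm_nonneg _) two_ne_zero).1 hsq

theorem projOdd_oddUnit (β : ℝ) : projOdd (oddUnit β) = oddUnit β := by
  rw [oddUnit, map_smul, ← mul_apply_eq_comp, isStarProjection_projOdd.isIdempotentElem.eq]

theorem projEven_evenUnit (β : ℝ) : projEven (evenUnit β) = evenUnit β := by
  rw [evenUnit, map_smul, ← mul_apply_eq_comp, isStarProjection_projEven.isIdempotentElem.eq]

theorem inner_eq_zero_of_odd_even {φ ψ : ModeC} (hφ : projOdd φ = φ) (hψ : projEven ψ = ψ) :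
    inner ℂ φ ψ = 0 := by
  have hsymm := isStarProjection_projOdd.isSelfAdjoint.isSymmetric φ (projEven ψ)
  rw [← hφ, ← hψ]
  refine hsymm.trans ?_
  rw [ContinuousLinearMap.coe_coe, ← mul_apply_eq_comp, projOdd_mul_projEven, zero_apply,
    inner_zero_right]

theorem coherentState_eq {β : ℝ} (hβ : β ≠ 0) : coherentState β =
    ((√(coefO β) : ℝ) : ℂ) • oddUnit β + ((√(coefE β) : ℝ) : ℂ) • evenUnit β := by
  have ho := (Real.sqrt_pos.2 (coefO_pos hβ)).ne'
  have he := (Real.sqrt_pos.2 (coefE_pos β)).ne'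
  rw [oddUnit, evenUnit, smul_smul, smul_smul, ← Complex.ofReal_mul, ← Complex.ofReal_mul,
    mul_inv_cancel₀ ho, mul_inv_cancel₀ he, projEven_eq_one_sub]
  simp

end Frame

section Compressions

variable {f : ℝ → ℝ} (hf : MemLp f ⊤ (volume : Measure ℝ)) (μ β : ℝ)
include hf

theorem opEO_eq : opEO f μ β = projEven * mulOp (memLp_weightOE hf μ β) * projOdd := by
  rw [opEO, ← ContinuousLinearMap.star_eq_adjoint, opOE_eq hf, star_mul, star_mul,
    isStarProjection_projOdd.isSelfAdjoint.star_eq, isStarProjection_projEven.isSelfAdjoint.star_eq,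
    (isSelfAdjoint_mulOp _).star_eq, mul_assoc]

theorem projOdd_mul_opOO : projOdd * opOO f μ β = opOO f μ β := by
  rw [opOO_eq hf, ← mul_assoc, ← mul_assoc, isStarProjection_projOdd.isIdempotentElem.eq]

theorem opOO_mul_projOdd : opOO f μ β * projOdd = opOO f μ β := by
  rw [opOO_eq hf, mul_assoc, isStarProjection_projOdd.isIdempotentElem.eq]

theorem projOdd_mul_opOE : projOdd * opOE f μ β = opOE f μ β := by
  rw [opOE_eq hf, ← mul_assoc, ← mul_assoc, isStarProjection_projOdd.isIdempotentElem.eq]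

theorem opOE_mul_projEven : opOE f μ β * projEven = opOE f μ β := by
  rw [opOE_eq hf, mul_assoc, isStarProjection_projEven.isIdempotentElem.eq]

theorem projEven_mul_opEO : projEven * opEO f μ β = opEO f μ β := by
  rw [opEO_eq hf, ← mul_assoc, ← mul_assoc, isStarProjection_projEven.isIdempotentElem.eq]

theorem opEO_mul_projOdd : opEO f μ β * projOdd = opEO f μ β := by
  rw [opEO_eq hf, mul_assoc, isStarProjection_projOdd.isIdempotentElem.eq]

theorem projEven_mul_opEE : projEven * opEE f μ β = opEE f μ β := by
  rw [opEE_eq hf, ← mul_assoc, ← mul_assoc, isStarProjection_projEven.isIdempotentElem.eq]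

theorem opEE_mul_projEven : opEE f μ β * projEven = opEE f μ β := by
  rw [opEE_eq hf, mul_assoc, isStarProjection_projEven.isIdempotentElem.eq]

theorem sectorOp_apply_of_odd (s : ℝ) {φ : ModeC} (hφ : projOdd φ = φ) :
    sectorOp f μ β s φ = opOO f μ β φ + (s : ℂ) • opEO f μ β φ := by
  have hE : projEven φ = 0 := by
    rw [← hφ, ← mul_apply_eq_comp, projEven_mul_projOdd, zero_apply]
  have hOE : opOE f μ β φ = 0 := by
    rw [← opOE_mul_projEven hf, mul_apply_eq_comp, hE, map_zero]
  have hEE : opEE f μ β φ = 0 := by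
    rw [← opEE_mul_projEven hf, mul_apply_eq_comp, hE, map_zero]
  simp only [sectorOp, add_apply, smul_apply, hOE, hEE, zero_add, add_zero]

theorem sectorOp_apply_of_even (s : ℝ) {φ : ModeC} (hφ : projEven φ = φ) :
    sectorOp f μ β s φ = (s : ℂ) • opOE f μ β φ + opEE f μ β φ := by
  have hO : projOdd φ = 0 := by rw [← hφ, ← mul_apply_eq_comp, projOdd_mul_projEven, zero_apply]
  have hOO : opOO f μ β φ = 0 := by
    rw [← opOO_mul_projOdd hf, mul_apply_eq_comp, hO, map_zero]
  have hEO : opEO f μ β φ = 0 := by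
    rw [← opEO_mul_projOdd hf, mul_apply_eq_comp, hO, map_zero]
  simp only [sectorOp, add_apply, smul_apply, hOO, hEO, zero_add, add_zero]

theorem braket_opOO_im : (braket β (opOO f μ β)).im = 0 :=
  (isRealWave_coherentState β).inner_im (isRealWave_opOO hf μ β (isRealWave_coherentState β))

theorem braket_opEE_im : (braket β (opEE f μ β)).im = 0 :=
  (isRealWave_coherentState β).inner_im (isRealWave_opEE hf μ β (isRealWave_coherentState β))

theorem braket_opOE_im : (braket β (opOE f μ β)).im = 0 :=
  (isRealWave_coherentState β).inner_im (isRealWave_opOE hf μ β (isRealWave_coherentState β))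

theorem braket_opOO_comp_opOE_im : (braket β (opOO f μ β ∘L opOE f μ β)).im = 0 :=
  (isRealWave_coherentState β).inner_im
    (isRealWave_opOO hf μ β (isRealWave_opOE hf μ β (isRealWave_coherentState β)))

theorem braket_opOE_comp_opEE_im : (braket β (opOE f μ β ∘L opEE f μ β)).im = 0 :=
  (isRealWave_coherentState β).inner_im
    (isRealWave_opOE hf μ β (isRealWave_opEE hf μ β (isRealWave_coherentState β)))

omit hf in
theorem inner_smul_apply_smul {P T Q : ModeC →L[ℂ] ModeC} (hP : IsSelfAdjoint P)
    (hPT : P * T = T) (hTQ : T * Q = T) (him : (braket β T).im = 0) (a b : ℝ) :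
    inner ℂ ((a : ℂ) • P (coherentState β)) (T ((b : ℂ) • Q (coherentState β))) =
      ((a * b * (braket β T).re : ℝ) : ℂ) := by
  have hsymm : inner ℂ (P (coherentState β)) (T (Q (coherentState β))) = braket β T := by
    refine (hP.isSymmetric _ _).trans ?_
    rw [ContinuousLinearMap.coe_coe, ← mul_apply_eq_comp, ← mul_apply_eq_comp, hPT, hTQ, braket]
  rw [map_smul, inner_smul_left, inner_smul_right, Complex.conj_ofReal, hsymm, Complex.ofReal_mul,
    Complex.ofReal_mul, mul_assoc, Complex.conj_eq_iff_re.1 (Complex.conj_eq_iff_im.2 him)]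

theorem inner_oddUnit_opOO :
    inner ℂ (oddUnit β) (opOO f μ β (oddUnit β)) = (lamOO f μ β : ℂ) := by
  rw [oddUnit, inner_smul_apply_smul β isStarProjection_projOdd.isSelfAdjoint
    (projOdd_mul_opOO hf μ β) (opOO_mul_projOdd hf μ β) (braket_opOO_im hf μ β), lamOO, ← mul_inv,
    Real.mul_self_sqrt (coefO_nonneg β)]

theorem inner_evenUnit_opEE :
    inner ℂ (evenUnit β) (opEE f μ β (evenUnit β)) = (lamEE f μ β : ℂ) := by
  rw [evenUnit, inner_smul_apply_smul β isStarProjection_projEven.isSelfAdjoint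
    (projEven_mul_opEE hf μ β) (opEE_mul_projEven hf μ β) (braket_opEE_im hf μ β), lamEE, ← mul_inv,
    Real.mul_self_sqrt (coefE_pos β).le]

theorem inner_oddUnit_opOE :
    inner ℂ (oddUnit β) (opOE f μ β (evenUnit β)) = (lamOE f μ β : ℂ) := by
  rw [oddUnit, evenUnit, inner_smul_apply_smul β isStarProjection_projOdd.isSelfAdjoint
    (projOdd_mul_opOE hf μ β) (opOE_mul_projEven hf μ β) (braket_opOE_im hf μ β), lamOE, ← mul_inv,
    ← Real.sqrt_mul (coefO_nonneg β)]

theorem inner_evenUnit_opEO :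
    inner ℂ (evenUnit β) (opEO f μ β (oddUnit β)) = (lamOE f μ β : ℂ) := by
  rw [opEO, ContinuousLinearMap.adjoint_inner_right, ← inner_conj_symm, inner_oddUnit_opOE hf,
    Complex.conj_ofReal]

theorem inner_opOO_opOE : inner ℂ (opOO f μ β (oddUnit β)) (opOE f μ β (evenUnit β)) =
    (((√(coefO β * coefE β))⁻¹ * (braket β (opOO f μ β ∘L opOE f μ β)).re : ℝ) : ℂ) := by
  refine ((isSelfAdjoint_opOO hf μ β).isSymmetric _ _).trans ?_
  rw [Real.sqrt_mul (coefO_nonneg β), mul_inv]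
  exact inner_smul_apply_smul β isStarProjection_projOdd.isSelfAdjoint
    (by rw [← ContinuousLinearMap.mul_def, ← mul_assoc, projOdd_mul_opOO hf])
    (by rw [← ContinuousLinearMap.mul_def, mul_assoc, opOE_mul_projEven hf])
    (braket_opOO_comp_opOE_im hf μ β) _ _

theorem inner_opEO_opEE : inner ℂ (opEO f μ β (oddUnit β)) (opEE f μ β (evenUnit β)) =
    (((√(coefO β * coefE β))⁻¹ * (braket β (opOE f μ β ∘L opEE f μ β)).re : ℝ) : ℂ) := by
  rw [opEO, ContinuousLinearMap.adjoint_inner_left, Real.sqrt_mul (coefO_nonneg β), mul_inv]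
  exact inner_smul_apply_smul β isStarProjection_projOdd.isSelfAdjoint
    (by rw [← ContinuousLinearMap.mul_def, ← mul_assoc, projOdd_mul_opOE hf])
    (by rw [← ContinuousLinearMap.mul_def, mul_assoc, opEE_mul_projEven hf])
    (braket_opOE_comp_opEE_im hf μ β) _ _

omit hf in
theorem norm_sq_apply_oddUnit {T : ModeC →L[ℂ] ModeC} (hT : T * projOdd = T) :
    ‖T (oddUnit β)‖ ^ 2 = (coefO β)⁻¹ * ‖T (coherentState β)‖ ^ 2 := by
  rw [oddUnit, map_smul, norm_inv_sqrt_smul (coefO_nonneg β), ← mul_apply_eq_comp, hT]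

omit hf in
theorem norm_sq_apply_evenUnit {T : ModeC →L[ℂ] ModeC} (hT : T * projEven = T) :
    ‖T (evenUnit β)‖ ^ 2 = (coefE β)⁻¹ * ‖T (coherentState β)‖ ^ 2 := by
  rw [evenUnit, map_smul, norm_inv_sqrt_smul (coefE_pos β).le, ← mul_apply_eq_comp, hT]

end Compressions

section SectorMatrix

open InnerProductSpace (gramSchmidtNormed)

/-- The odd vectors spanning the invariant part of the sector `s`, in the order in which they are
orthonormalised. -/
def oddTriple (f : ℝ → ℝ) (μ β s : ℝ) : Fin 3 → ModeC :=
  ![oddUnit β, opOO f μ β (oddUnit β), (s : ℂ) • opOE f μ β (evenUnit β)]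

/-- The even vectors spanning the invariant part of the sector `s`, in the order in which they are
orthonormalised. -/
def evenTriple (f : ℝ → ℝ) (μ β s : ℝ) : Fin 3 → ModeC :=
  ![evenUnit β, (s : ℂ) • opEO f μ β (oddUnit β), opEE f μ β (evenUnit β)]

/-- The Gram–Schmidt frame of the sector `s` in the order of the rows of `mat0` and `mat1`: the
odd vectors come first and backwards, so that the two components of `|β⟩` stand in the middle. -/
def sectorFrame (f : ℝ → ℝ) (μ β s : ℝ) : Fin 6 → ModeC :=
  Sum.elim (gramSchmidtNormed ℂ (oddTriple f μ β s)) (gramSchmidtNormed ℂ (evenTriple f μ β s)) ∘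
    ![.inl 2, .inl 1, .inl 0, .inr 0, .inr 1, .inr 2]

/-- The common form of `mat0` and `mat1`: the matrix of `sectorTotal` in the frame `sectorFrame`,
in which the two outermost blocks carry the a priori bound `1` of the phase error operator. -/
def sectorMatrix (f : ℝ → ℝ) (μ β κ γo γe s : ℝ) : Matrix (Fin 6) (Fin 6) ℝ :=
  let Co := coefO β
  let Ce := coefE β
  let loo := lamOO f μ β
  let lee := lamEE f μ β
  let loe := s * lamOE f μ β
  let soo := sigOO f μ β
  let seo := sigEO f μ β
  let soe := s * sigOE f μ β
  let see := s * sigEE f μ β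
  let doe := delOE f μ β
  let dee := delEE f μ β
  let r := √(Co * Ce)
  !![1 - γo, 0, 0, doe, 0, 0;
     0, 1 - γo, soo, soe, 0, 0;
     0, soo, κ * Co + loo - γo, κ * r + loe, seo, 0;
     doe, soe, κ * r + loe, κ * Ce + lee - γe, see, dee;
     0, 0, seo, see, 1 - γe, 0;
     0, 0, 0, dee, 0, 1 - γe]

theorem sectorMatrix_one (f : ℝ → ℝ) (μ β κ γ : ℝ) :
    sectorMatrix f μ β κ 0 γ 1 = mat0 f μ β κ γ := by
  simp only [sectorMatrix, mat0, sub_zero, one_mul]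

theorem sectorMatrix_neg_one (f : ℝ → ℝ) (μ β κ γ : ℝ) :
    sectorMatrix f μ β κ γ 0 (-1) = mat1 f μ β κ γ := by
  simp only [sectorMatrix, mat1, sub_zero, neg_one_mul, ← sub_eq_add_neg]

theorem isHermitian_sectorMatrix (f : ℝ → ℝ) (μ β κ γo γe s : ℝ) :
    (sectorMatrix f μ β κ γo γe s).IsHermitian := by
  ext i j
  fin_cases i <;> fin_cases j <;> rfl

theorem sectorMatrix_convex_comb (f : ℝ → ℝ) (μ β s : ℝ) {a b : ℝ} (hab : a + b = 1)
    (κ κ' γo γo' γe γe' : ℝ) :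
    sectorMatrix f μ β (a * κ + b * κ') (a * γo + b * γo') (a * γe + b * γe') s =
      a • sectorMatrix f μ β κ γo γe s + b • sectorMatrix f μ β κ' γo' γe' s := by
  obtain rfl : b = 1 - a := by linarith
  ext i j
  fin_cases i <;> fin_cases j <;> simp [sectorMatrix] <;> ring

theorem convexOn_specSup_sectorMatrix (f : ℝ → ℝ) (μ β s t u : ℝ) :
    ConvexOn ℝ Set.univ fun p : ℝ × ℝ =>
      specSup (sectorMatrix f μ β p.1 (t * p.2) (u * p.2) s) := by
  refine ⟨convex_univ, fun p _ q _ a b ha hb hab => ?_⟩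
  have h := convexOn_sSup_spectrum.2 (isHermitian_sectorMatrix f μ β p.1 (t * p.2) (u * p.2) s)
    (isHermitian_sectorMatrix f μ β q.1 (t * q.2) (u * q.2) s) ha hb hab
  rw [← sectorMatrix_convex_comb f μ β s hab, mul_left_comm a, mul_left_comm b, ← mul_add,
    mul_left_comm a, mul_left_comm b, ← mul_add] at h
  exact h

theorem convexOn_boundB (f : ℝ → ℝ) (μ β : ℝ) :
    ConvexOn ℝ Set.univ fun p : ℝ × ℝ => boundB f μ β p.1 p.2 := by
  have h := (convexOn_specSup_sectorMatrix f μ β 1 0 1).sup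
    (convexOn_specSup_sectorMatrix f μ β (-1) 1 0)
  simp only [zero_mul, one_mul, sectorMatrix_one, sectorMatrix_neg_one] at h
  exact h

section Frame

variable {f : ℝ → ℝ} (hf : MemLp f ⊤ (volume : Measure ℝ)) (μ β s : ℝ)
include hf

theorem projOdd_gramSchmidtNormed_oddTriple (i : Fin 3) :
    projOdd (gramSchmidtNormed ℂ (oddTriple f μ β s) i) =
      gramSchmidtNormed ℂ (oddTriple f μ β s) i := by
  refine map_gramSchmidtNormed_eq_self (P := (projOdd : ModeC →ₗ[ℂ] ModeC)) (fun j => ?_) i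
  fin_cases j
  · exact projOdd_oddUnit β
  · exact DFunLike.congr_fun (projOdd_mul_opOO hf μ β) _
  · exact (map_smul _ _ _).trans (congrArg _ (DFunLike.congr_fun (projOdd_mul_opOE hf μ β) _))

theorem projEven_gramSchmidtNormed_evenTriple (i : Fin 3) :
    projEven (gramSchmidtNormed ℂ (evenTriple f μ β s) i) =
      gramSchmidtNormed ℂ (evenTriple f μ β s) i := by
  refine map_gramSchmidtNormed_eq_self (P := (projEven : ModeC →ₗ[ℂ] ModeC)) (fun j => ?_) i
  fin_cases j
  · exact projEven_evenUnit β
  · exact (map_smul _ _ _).trans (congrArg _ (DFunLike.congr_fun (projEven_mul_opEO hf μ β) _))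
  · exact DFunLike.congr_fun (projEven_mul_opEE hf μ β) _

theorem isOrthonormalOrZero_sectorFrame : IsOrthonormalOrZero ℂ (sectorFrame f μ β s) :=
  ((isOrthonormalOrZero_gramSchmidtNormed _).sumElim
    (isOrthonormalOrZero_gramSchmidtNormed _) fun i j => inner_eq_zero_of_odd_even
      (projOdd_gramSchmidtNormed_oddTriple hf μ β s i)
      (projEven_gramSchmidtNormed_evenTriple hf μ β s j)).comp (by decide)

end Frame

section GramSchmidtCoefficients

variable {f : ℝ → ℝ} (hf : MemLp f ⊤ (volume : Measure ℝ)) (μ : ℝ) {β s : ℝ}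
include hf

theorem gramSchmidtNormed_oddTriple (hβ : β ≠ 0) (hs : s ^ 2 = 1) :
    gramSchmidtNormed ℂ (oddTriple f μ β s) 0 = oddUnit β ∧
      opOO f μ β (oddUnit β) = (lamOO f μ β : ℂ) • oddUnit β +
        (sigOO f μ β : ℂ) • gramSchmidtNormed ℂ (oddTriple f μ β s) 1 ∧
      (s : ℂ) • opOE f μ β (evenUnit β) = ((s * lamOE f μ β : ℝ) : ℂ) • oddUnit β +
        ((s * sigOE f μ β : ℝ) : ℂ) • gramSchmidtNormed ℂ (oddTriple f μ β s) 1 +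
        (delOE f μ β : ℂ) • gramSchmidtNormed ℂ (oddTriple f μ β s) 2 := by
  have hm : inner ℂ (oddUnit β) ((s : ℂ) • opOE f μ β (evenUnit β)) = (s * lamOE f μ β : ℝ) := by
    rw [inner_smul_right, inner_oddUnit_opOE hf, Complex.ofReal_mul]
  have hn : inner ℂ (opOO f μ β (oddUnit β)) ((s : ℂ) • opOE f μ β (evenUnit β)) =
      (s * ((√(coefO β * coefE β))⁻¹ * (braket β (opOO f μ β ∘L opOE f μ β)).re) : ℝ) := by
    rw [inner_smul_right, inner_opOO_opOE hf, Complex.ofReal_mul s]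
  have hσ : sigOO f μ β = √(‖opOO f μ β (oddUnit β)‖ ^ 2 - lamOO f μ β ^ 2) := by
    rw [norm_sq_apply_oddUnit β (opOO_mul_projOdd hf μ β), sigOO]
  have hδ : delOE f μ β = √(‖(s : ℂ) • opOE f μ β (evenUnit β)‖ ^ 2 - (s * lamOE f μ β) ^ 2 -
      (s * sigOE f μ β) ^ 2) := by
    rw [norm_smul, mul_pow, Complex.norm_real, Real.norm_eq_abs, sq_abs, mul_pow, mul_pow, hs,
      one_mul, one_mul, one_mul, norm_sq_apply_evenUnit β (opOE_mul_projEven hf μ β), delOE]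
  exact gramSchmidt_fin_three (f := oddTriple f μ β s) (l := lamOO f μ β) (m := s * lamOE f μ β)
    (n := s * ((√(coefO β * coefE β))⁻¹ * (braket β (opOO f μ β ∘L opOE f μ β)).re))
    (σ := sigOO f μ β) (s := s * sigOE f μ β) (norm_oddUnit hβ) (inner_oddUnit_opOO hf μ β) hm hn
    hσ (by rw [sigOE]; ring) hδ

theorem gramSchmidtNormed_evenTriple (β) (hs : s ^ 2 = 1) :
    gramSchmidtNormed ℂ (evenTriple f μ β s) 0 = evenUnit β ∧
      (s : ℂ) • opEO f μ β (oddUnit β) = ((s * lamOE f μ β : ℝ) : ℂ) • evenUnit β +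
        (sigEO f μ β : ℂ) • gramSchmidtNormed ℂ (evenTriple f μ β s) 1 ∧
      opEE f μ β (evenUnit β) = (lamEE f μ β : ℂ) • evenUnit β +
        ((s * sigEE f μ β : ℝ) : ℂ) • gramSchmidtNormed ℂ (evenTriple f μ β s) 1 +
        (delEE f μ β : ℂ) • gramSchmidtNormed ℂ (evenTriple f μ β s) 2 := by
  have hl : inner ℂ (evenUnit β) ((s : ℂ) • opEO f μ β (oddUnit β)) = (s * lamOE f μ β : ℝ) := by
    rw [inner_smul_right, inner_evenUnit_opEO hf, Complex.ofReal_mul]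
  have hn : inner ℂ ((s : ℂ) • opEO f μ β (oddUnit β)) (opEE f μ β (evenUnit β)) =
      (s * ((√(coefO β * coefE β))⁻¹ * (braket β (opOE f μ β ∘L opEE f μ β)).re) : ℝ) := by
    rw [inner_smul_left, inner_opEO_opEE hf, Complex.conj_ofReal, Complex.ofReal_mul s]
  have hσ : sigEO f μ β = √(‖(s : ℂ) • opEO f μ β (oddUnit β)‖ ^ 2 - (s * lamOE f μ β) ^ 2) := by
    rw [norm_smul, mul_pow, Complex.norm_real, Real.norm_eq_abs, sq_abs, mul_pow, hs, one_mul,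
      one_mul, norm_sq_apply_oddUnit β (opEO_mul_projOdd hf μ β), sigEO]
  have hδ : delEE f μ β = √(‖opEE f μ β (evenUnit β)‖ ^ 2 - lamEE f μ β ^ 2 -
      (s * sigEE f μ β) ^ 2) := by
    rw [mul_pow, hs, one_mul, norm_sq_apply_evenUnit β (opEE_mul_projEven hf μ β), delEE]
  exact gramSchmidt_fin_three (f := evenTriple f μ β s) (l := s * lamOE f μ β) (m := lamEE f μ β)
    (n := s * ((√(coefO β * coefE β))⁻¹ * (braket β (opOE f μ β ∘L opEE f μ β)).re))
    (σ := sigEO f μ β) (s := s * sigEE f μ β) (norm_evenUnit β) hl (inner_evenUnit_opEE hf μ β) hn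
    hσ (by rw [sigEE]; ring) hδ

end GramSchmidtCoefficients

end SectorMatrix

section SectorBound

open InnerProductSpace (gramSchmidtNormed)

/-- The part of `sectorTotal` that is left when the phase error operator is replaced by its a priori
bound `1` and the rank one term is dropped. -/
def sectorRemainder (γo γe : ℝ) : ModeC →L[ℂ] ModeC :=
  1 - ((γo : ℂ) • projOdd + (γe : ℂ) • projEven)

theorem projEven_apply_of_odd {φ : ModeC} (hφ : projOdd φ = φ) : projEven φ = 0 := by
  rw [projEven_eq_one_sub, sub_apply, hφ, one_apply_eq_self, sub_self]

theorem projOdd_apply_of_even {φ : ModeC} (hφ : projEven φ = φ) : projOdd φ = 0 := by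
  rw [← hφ, ← mul_apply_eq_comp, projOdd_mul_projEven, zero_apply]

theorem sectorRemainder_apply_of_odd (γo γe : ℝ) {φ : ModeC} (hφ : projOdd φ = φ) :
    sectorRemainder γo γe φ = ((1 - γo : ℝ) : ℂ) • φ := by
  simp only [sectorRemainder, sub_apply, add_apply, smul_apply, one_apply_eq_self, hφ,
    projEven_apply_of_odd hφ]
  push_cast
  module

theorem sectorRemainder_apply_of_even (γo γe : ℝ) {φ : ModeC} (hφ : projEven φ = φ) :
    sectorRemainder γo γe φ = ((1 - γe : ℝ) : ℂ) • φ := by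
  simp only [sectorRemainder, sub_apply, add_apply, smul_apply, one_apply_eq_self, hφ,
    projOdd_apply_of_even hφ]
  push_cast
  module

theorem isSelfAdjoint_sectorRemainder (γo γe : ℝ) : IsSelfAdjoint (sectorRemainder γo γe) := by
  have hreal (r : ℝ) : IsSelfAdjoint (r : ℂ) := Complex.conj_ofReal r
  exact (IsSelfAdjoint.one _).sub (((hreal γo).smul isStarProjection_projOdd.isSelfAdjoint).add
    ((hreal γe).smul isStarProjection_projEven.isSelfAdjoint))

theorem re_inner_sectorRemainder_le {γo γe c : ℝ} (ho : 1 - γo ≤ c) (he : 1 - γe ≤ c)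
    (η : ModeC) : (inner ℂ η (sectorRemainder γo γe η)).re ≤ c * ‖η‖ ^ 2 := by
  have hsq := norm_sq_projOdd_add_norm_sq_projEven η
  have hinner : (inner ℂ η (sectorRemainder γo γe η)).re =
      ‖η‖ ^ 2 - (γo * ‖projOdd η‖ ^ 2 + γe * ‖projEven η‖ ^ 2) := by
    rw [norm_sq_apply_of_isStarProjection isStarProjection_projOdd,
      norm_sq_apply_of_isStarProjection isStarProjection_projEven]
    simp only [sectorRemainder, sub_apply, add_apply, smul_apply, one_apply_eq_self,
      inner_sub_right, inner_add_right, inner_smul_right, Complex.sub_re, Complex.add_re,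
      Complex.re_ofReal_mul, norm_sq_eq_re_inner (𝕜 := ℂ) η, RCLike.re_to_complex]
  rw [hinner, ← hsq]
  nlinarith [sq_nonneg ‖projOdd η‖, sq_nonneg ‖projEven η‖]

theorem inner_coherentState_oddUnit {β : ℝ} (hβ : β ≠ 0) :
    inner ℂ (coherentState β) (oddUnit β) = (√(coefO β) : ℝ) := by
  rw [coherentState_eq hβ, inner_add_left, inner_smul_left, inner_smul_left,
    inner_self_eq_norm_sq_to_K, norm_oddUnit hβ, inner_eq_zero_symm.1
      (inner_eq_zero_of_odd_even (projOdd_oddUnit β) (projEven_evenUnit β)), Complex.conj_ofReal]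
  simp

theorem inner_coherentState_evenUnit {β : ℝ} (hβ : β ≠ 0) :
    inner ℂ (coherentState β) (evenUnit β) = (√(coefE β) : ℝ) := by
  rw [coherentState_eq hβ, inner_add_left, inner_smul_left, inner_smul_left,
    inner_self_eq_norm_sq_to_K, norm_evenUnit β,
      inner_eq_zero_of_odd_even (projOdd_oddUnit β) (projEven_evenUnit β), Complex.conj_ofReal]
  simp

theorem sectorTotal_apply (f : ℝ → ℝ) (μ β κ γo γe s : ℝ) (φ : ModeC) :
    sectorTotal f μ β κ γo γe s φ = sectorOp f μ β s φ +
      ((κ : ℂ) * inner ℂ (coherentState β) φ) • coherentState β -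
      ((γo : ℂ) • projOdd φ + (γe : ℂ) • projEven φ) := by
  simp only [sectorTotal, sub_apply, add_apply, smul_apply, InnerProductSpace.rankOne_apply,
    smul_smul]

variable {f : ℝ → ℝ} (hf : MemLp f ⊤ (volume : Measure ℝ)) (μ : ℝ) {β s : ℝ}
include hf

theorem sectorTotal_oddUnit (hβ : β ≠ 0) (hs : s ^ 2 = 1) (κ γo γe : ℝ) :
    sectorTotal f μ β κ γo γe s (oddUnit β) =
      ∑ i, ((sectorMatrix f μ β κ γo γe s i 2 : ℝ) : ℂ) • sectorFrame f μ β s i := by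
  obtain ⟨hp, hoo, -⟩ := gramSchmidtNormed_oddTriple hf μ hβ hs
  obtain ⟨hk, heo, -⟩ := gramSchmidtNormed_evenTriple hf μ β hs
  rw [sectorTotal_apply, sectorOp_apply_of_odd hf μ β s (projOdd_oddUnit β),
    inner_coherentState_oddUnit hβ, projOdd_oddUnit, projEven_apply_of_odd (projOdd_oddUnit β),
    hoo, heo, coherentState_eq hβ]
  have hsq : (coefO β : ℂ) = (√(coefO β) : ℝ) * (√(coefO β) : ℝ) := by
    rw [← Complex.ofReal_mul, Real.mul_self_sqrt (coefO_nonneg β)]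
  have hr : √(coefO β * coefE β) = √(coefO β) * √(coefE β) := Real.sqrt_mul (coefO_nonneg β) _
  simp only [Fin.sum_univ_six, sectorMatrix, sectorFrame, Function.comp_apply, Sum.elim_inl,
    Sum.elim_inr, Matrix.of_apply, Matrix.cons_val, hp, hk, hr, Complex.ofReal_zero,
    Complex.ofReal_add, Complex.ofReal_sub, Complex.ofReal_mul]
  rw [hsq]
  module

theorem sectorTotal_evenUnit (hβ : β ≠ 0) (hs : s ^ 2 = 1) (κ γo γe : ℝ) :
    sectorTotal f μ β κ γo γe s (evenUnit β) =
      ∑ i, ((sectorMatrix f μ β κ γo γe s i 3 : ℝ) : ℂ) • sectorFrame f μ β s i := by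
  obtain ⟨hp, -, hoe⟩ := gramSchmidtNormed_oddTriple hf μ hβ hs
  obtain ⟨hk, -, hee⟩ := gramSchmidtNormed_evenTriple hf μ β hs
  rw [sectorTotal_apply, sectorOp_apply_of_even hf μ β s (projEven_evenUnit β),
    inner_coherentState_evenUnit hβ, projEven_evenUnit, projOdd_apply_of_even (projEven_evenUnit β),
    hoe, hee, coherentState_eq hβ]
  have hsq : (coefE β : ℂ) = (√(coefE β) : ℝ) * (√(coefE β) : ℝ) := by
    rw [← Complex.ofReal_mul, Real.mul_self_sqrt (coefE_pos β).le]
  have hr : √(coefO β * coefE β) = √(coefO β) * √(coefE β) := Real.sqrt_mul (coefO_nonneg β) _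
  simp only [Fin.sum_univ_six, sectorMatrix, sectorFrame, Function.comp_apply, Sum.elim_inl,
    Sum.elim_inr, Matrix.of_apply, Matrix.cons_val, hp, hk, hr, Complex.ofReal_add,
    Complex.ofReal_sub, Complex.ofReal_mul]
  rw [hsq]
  module

theorem sectorRemainder_sectorFrame (β s κ γo γe : ℝ) {j : Fin 6}
    (hj : j ∉ ({2, 3} : Finset (Fin 6))) :
    sectorRemainder γo γe (sectorFrame f μ β s j) = ∑ i ∈ ({2, 3} : Finset (Fin 6))ᶜ,
      ((sectorMatrix f μ β κ γo γe s i j : ℝ) : ℂ) • sectorFrame f μ β s i := by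
  have ho (i : Fin 3) := sectorRemainder_apply_of_odd γo γe
    (projOdd_gramSchmidtNormed_oddTriple hf μ β s i)
  have he (i : Fin 3) := sectorRemainder_apply_of_even γo γe
    (projEven_gramSchmidtNormed_evenTriple hf μ β s i)
  rw [show ({2, 3} : Finset (Fin 6))ᶜ = {0, 1, 4, 5} by decide]
  fin_cases j <;> simp [sectorMatrix, sectorFrame, ho, he, -Complex.coe_smul] at hj ⊢

theorem re_inner_sectorTotal_le_sectorRemainder (hf_le : ∀ x, f x + f (-x) ≤ 1) (hβ : β ≠ 0)
    (hs : s ^ 2 = 1) (κ γo γe : ℝ) {ξ : ModeC} (ho : inner ℂ (oddUnit β) ξ = 0)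
    (he : inner ℂ (evenUnit β) ξ = 0) : (inner ℂ ξ (sectorTotal f μ β κ γo γe s ξ)).re ≤
      (inner ℂ ξ (sectorRemainder γo γe ξ)).re := by
  have hinner : inner ℂ (coherentState β) ξ = 0 := by
    rw [coherentState_eq hβ, inner_add_left, inner_smul_left, inner_smul_left, ho, he, mul_zero,
      mul_zero, add_zero]
  rw [sectorTotal_apply, hinner, mul_zero, zero_smul, add_zero, sectorRemainder, sub_apply,
    one_apply_eq_self, inner_sub_right, inner_sub_right, Complex.sub_re, Complex.sub_re]
  refine sub_le_sub_right ((re_inner_sectorOp_le hf hf_le μ β hs ξ).trans_eq ?_) _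
  exact norm_sq_eq_re_inner (𝕜 := ℂ) ξ

theorem re_inner_sectorTotal_le (hf_le : ∀ x, f x + f (-x) ≤ 1) (hβ : β ≠ 0) (hs : s ^ 2 = 1)
    (κ γo γe : ℝ) (χ : ModeC) : (inner ℂ χ (sectorTotal f μ β κ γo γe s χ)).re ≤
      specSup (sectorMatrix f μ β κ γo γe s) * ‖χ‖ ^ 2 := by
  have hM := isHermitian_sectorMatrix f μ β κ γo γe s
  have hodd : sectorFrame f μ β s 2 = oddUnit β := (gramSchmidtNormed_oddTriple hf μ hβ hs).1
  have heven : sectorFrame f μ β s 3 = evenUnit β := (gramSchmidtNormed_evenTriple hf μ β hs).1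
  refine (isOrthonormalOrZero_sectorFrame hf μ β s).re_inner_map_le
    (T := (sectorTotal f μ β κ γo γe s : ModeC →ₗ[ℂ] ModeC))
    (D := (sectorRemainder γo γe : ModeC →ₗ[ℂ] ModeC))
    (M := (sectorMatrix f μ β κ γo γe s).map fun r => (r : ℂ)) (s := {2, 3})
    (isSelfAdjoint_sectorTotal hf μ β κ γo γe s).isSymmetric
    (isSelfAdjoint_sectorRemainder γo γe).isSymmetric
    (hM.map _ fun r => (Complex.conj_ofReal r).symm) (fun j hj => ?_)
    (fun j hj => sectorRemainder_sectorFrame hf μ β s κ γo γe hj)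
    (fun ξ hξ => re_inner_sectorTotal_le_sectorRemainder hf μ hf_le hβ hs κ γo γe ?_ ?_)
    (re_dotProduct_map_ofReal_mulVec_le hM)
    (re_inner_sectorRemainder_le (apply_self_le_sSup_spectrum hM 0)
      (apply_self_le_sSup_spectrum hM 5)) χ
  · obtain rfl | rfl : j = 2 ∨ j = 3 := by simpa using hj
    · rw [hodd]
      exact sectorTotal_oddUnit hf μ hβ hs κ γo γe
    · rw [heven]
      exact sectorTotal_evenUnit hf μ hβ hs κ γo γe
  · exact hodd ▸ hξ 2 (by decide)
  · exact heven ▸ hξ 3 (by decide)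

end SectorBound

theorem isPositive_smul_one_sub_sectorTotal {f : ℝ → ℝ} (hf : MemLp f ⊤ (volume : Measure ℝ))
    (hf_le : ∀ x, f x + f (-x) ≤ 1) (μ : ℝ) {β s c κ γo γe : ℝ} (hβ : β ≠ 0) (hs : s ^ 2 = 1)
    (hc : specSup (sectorMatrix f μ β κ γo γe s) ≤ c) :
    ((c : ℂ) • 1 - sectorTotal f μ β κ γo γe s).IsPositive := by
  have hreal : IsSelfAdjoint (c : ℂ) := Complex.conj_ofReal c
  refine ContinuousLinearMap.isPositive_def'.2 ⟨(hreal.smul (IsSelfAdjoint.one _)).sub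
    (isSelfAdjoint_sectorTotal hf μ β κ γo γe s), fun χ => ?_⟩
  have hχ : (inner ℂ χ (sectorTotal f μ β κ γo γe s χ)).re ≤ c * ‖χ‖ ^ 2 :=
    (re_inner_sectorTotal_le hf μ hf_le hβ hs κ γo γe χ).trans
      (mul_le_mul_of_nonneg_right hc (sq_nonneg _))
  rw [ContinuousLinearMap.reApplyInnerSelf_apply, inner_re_symm, sub_apply, smul_apply,
    one_apply_eq_self, inner_sub_right, inner_smul_right, map_sub, RCLike.re_to_complex,
    RCLike.re_to_complex, Complex.re_ofReal_mul]
  rw [norm_sq_eq_re_inner (𝕜 := ℂ) χ] at hχ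
  exact sub_nonneg.2 hχ

theorem opM_le_smul_id {f : ℝ → ℝ} (hf : MemLp f ⊤ (volume : Measure ℝ))
    (hf_nonneg : ∀ x, 0 ≤ f x) (hf_le : ∀ x, f x + f (-x) ≤ 1) {μ β : ℝ} (hβ : β ≠ 0)
    (hβμ : β ^ 2 < μ) (κ γ : ℝ) :
    opM f μ β κ γ ≤ (boundB f μ β κ γ : ℂ) • ContinuousLinearMap.id ℂ SpaceAC := by
  rw [ContinuousLinearMap.le_def, opM_eq_sectorSum hf hf_nonneg hβμ, ← sectorSum_one, ← map_smul,
    ← map_sub]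
  refine isPositive_sectorSum
    (isPositive_smul_one_sub_sectorTotal hf hf_le μ hβ (one_pow 2) (le_max_of_le_left ?_))
    (isPositive_smul_one_sub_sectorTotal hf hf_le μ hβ neg_one_sq (le_max_of_le_right ?_))
  · norm_num [sectorMatrix_one]
  · norm_num [sectorMatrix_neg_one]

end

end HomodyneQKD

theorem mainTheorem2_general {f : ℝ → ℝ} (hf_meas : Measurable f) (hf_nonneg : ∀ x, 0 ≤ f x)
    (hf_le : ∀ x, f x + f (-x) ≤ 1) {μ β : ℝ} (hβ : β ≠ 0) (hβμ : β ^ 2 < μ) :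
    (IsOpIntegral (phaseErrorForm f μ β) (phaseErrorOp f μ β) ∧
      IsOpIntegral (formOO f μ β) (opOO f μ β) ∧
      IsOpIntegral (formEE f μ β) (opEE f μ β) ∧
      IsOpIntegral (formOE f μ β) (opOE f μ β) ∧
      IsOpIntegral (formOE' f μ β) (opOE' f μ β) ∧
      opOE' f μ β = -opOE f μ β ∧
      braket β projOdd = ((Real.exp (-β ^ 2) * Real.sinh (β ^ 2) : ℝ) : ℂ) ∧
      braket β projEven = ((Real.exp (-β ^ 2) * Real.cosh (β ^ 2) : ℝ) : ℂ) ∧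
      (braket β (opOO f μ β)).im = 0 ∧
      (braket β (opEE f μ β)).im = 0 ∧
      (braket β (opOE f μ β)).im = 0 ∧
      (braket β (opOO f μ β ∘L opOE f μ β)).im = 0 ∧
      (braket β (opOE f μ β ∘L opEE f μ β)).im = 0) ∧
    ConvexOn ℝ Set.univ (fun p : ℝ × ℝ => boundB f μ β p.1 p.2) ∧
    ∀ κ γ : ℝ,
      opM f μ β κ γ ≤ (boundB f μ β κ γ : ℂ) • ContinuousLinearMap.id ℂ SpaceAC := by
  have hf : MemLp f ⊤ (volume : Measure ℝ) :=
    memLp_top_of_bound hf_meas.aestronglyMeasurable 1 <| .of_forall fun x => by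
      rw [Real.norm_eq_abs, abs_of_nonneg (hf_nonneg x)]
      linarith [hf_le x, hf_nonneg (-x)]
  have hphase := isOpIntegral_phaseErrorForm hf hf_nonneg hβμ
  have hOE' : opOE' f μ β = -opOE f μ β := (isOpIntegral_neg_opOE hf μ β).opIntegral_eq
  exact ⟨⟨by rwa [phaseErrorOp, hphase.opIntegral_eq], isOpIntegral_opOO hf μ β,
    isOpIntegral_opEE hf μ β, isOpIntegral_opOE hf μ β, hOE' ▸ isOpIntegral_neg_opOE hf μ β, hOE',
    braket_projOdd β, braket_projEven β, braket_opOO_im hf μ β, braket_opEE_im hf μ β,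
    braket_opOE_im hf μ β, braket_opOO_comp_opOE_im hf μ β, braket_opOE_comp_opEE_im hf μ β⟩,
    convexOn_boundB f μ β, opM_le_smul_id hf hf_nonneg hf_le hβ hβμ⟩

/-- Operator inequality for the Homodyne protocol. The first block of conclusions says that the
operator integrals in the definitions exist and that the parameters are real, with the stated
values of the two squared norms. -/
theorem mainTheorem2 (f : ℝ → ℝ) (hf_meas : Measurable f) (hf_nonneg : ∀ x, 0 ≤ f x)
    (hf_le : ∀ x, f x + f (-x) ≤ 1) (μ β : ℝ) (hβ : 0 < β) (hβμ : β < Real.sqrt μ) :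
    (IsOpIntegral (phaseErrorForm f μ β) (phaseErrorOp f μ β) ∧
      IsOpIntegral (formOO f μ β) (opOO f μ β) ∧
      IsOpIntegral (formEE f μ β) (opEE f μ β) ∧
      IsOpIntegral (formOE f μ β) (opOE f μ β) ∧
      IsOpIntegral (formOE' f μ β) (opOE' f μ β) ∧
      opOE' f μ β = -opOE f μ β ∧
      braket β projOdd = ((Real.exp (-β ^ 2) * Real.sinh (β ^ 2) : ℝ) : ℂ) ∧
      braket β projEven = ((Real.exp (-β ^ 2) * Real.cosh (β ^ 2) : ℝ) : ℂ) ∧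
      (braket β (opOO f μ β)).im = 0 ∧
      (braket β (opEE f μ β)).im = 0 ∧
      (braket β (opOE f μ β)).im = 0 ∧
      (braket β (opOO f μ β ∘L opOE f μ β)).im = 0 ∧
      (braket β (opOE f μ β ∘L opEE f μ β)).im = 0) ∧
    ConvexOn ℝ Set.univ (fun p : ℝ × ℝ => boundB f μ β p.1 p.2) ∧
    ∀ κ γ : ℝ, 0 ≤ κ → 0 ≤ γ →
      opM f μ β κ γ ≤ (boundB f μ β κ γ : ℂ) • ContinuousLinearMap.id ℂ SpaceAC :=
  have h := mainTheorem2_general hf_meas hf_nonneg hf_le hβ.ne' ((Real.lt_sqrt hβ.le).1 hβμ)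
  ⟨h.1, h.2.1, fun κ γ _ _ => h.2.2 κ γ⟩
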